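/- All rings are commutative. Let $\kappa$ be an infinite cardinal. A module $M$ over a ring $R$ is Mittag-Leffler if for every family $(Q_i)_{i\in I}$ of $R$-modules the canonical map $M\otimes_R\prod_{i\in I} Q_i\to\prod_{i\in I}(M\otimes_R Q_i)$ is injective. It is $\le\kappa$-presented if there is an exact sequence $R^{(J)}\to R^{(I)}\to M\to 0$ with $|I|,|J|\le\kappa$. It is a $\kappa$-restricted flat Mittag-Leffler module if it is a transfinite extension of $\le\kappa$-presented flat Mittag-Leffler modules, that is, if there are an ordinal $\sigma$ and an increasing chain $(M_\alpha\mid\alpha\le\sigma)$ of submodules of $M$ with $M_0=0$, $M_\sigma=M$, $M_\alpha=\bigcup_{\beta<\alpha}M_\beta$ for each limit ordinal $\alpha\le\sigma$, and $M_{\alpha+1}/M_\alpha$ isomorphic to a $\le\kappa$-presented flat Mittag-Leffler $R$-module for each $\alpha<\sigma$. A $\kappa$-restricted Drinfeld vector bundle on a scheme $X$ is a quasi-coherent sheaf $\mathcal M$ on $X$ such that for each affine open $U\subseteq X$ the $\mathcal O_X(U)$-module $\mathcal M(U)$ is a $\kappa$-restricted flat Mittag-Leffler module. **Theorem.** Let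 $\kappa$ be an infinite cardinal. 1. Being a $\kappa$-restricted flat Mittag-Leffler module is an ad-property: if $R\to S$ is a flat ring homomorphism and $M$ is a $\kappa$-restricted flat Mittag-Leffler $R$-module, then $M\otimes_R S$ is a $\kappa$-restricted flat Mittag-Leffler $S$-module; and if $R\to S$ is a faithfully flat ring homomorphism and $M$ is an $R$-module such that $M\otimes_R S$ is a $\kappa$-restricted flat Mittag-Leffler $S$-module, then $M$ is a $\kappa$-restricted flat Mittag-Leffler $R$-module. 2. The notion of a $\kappa$-restricted Drinfeld vector bundle is Zariski local on every scheme: if $X$ is a scheme, $\mathcal M$ is a quasi-coherent sheaf on $X$, and $\mathcal U$ is any set of affine open subsets of $X$ with $\bigcup\mathcal U=X$, then $\mathcal M$ is a $\kappa$-restricted Drinfeld vector bundle if and only if $\mathcal M(U)$ is a $\kappa$-restricted flat Mittag-Leffler $\mathcal O_X(U)$-module for every $U\in\mathcal U$. -/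

import Mathlib

open scoped TensorProduct Cardinal AlgebraicGeometry

universe u

namespace RestrictedML

section Modules

variable (R : Type u) [CommRing R] (M : Type u) [AddCommGroup M] [Module R M]

/-- `M` is Mittag-Leffler: for every family `(Q i)` of `R`-modules, the canonical map
`M ⊗ ∏ i, Q i → ∏ i, M ⊗ Q i`, `m ⊗ q ↦ (m ⊗ q i)_i`, is injective. -/
def IsMittagLeffler : Prop :=
  ∀ (ι : Type u) (Q : ι → Type u) [∀ i, AddCommGroup (Q i)] [∀ i, Module R (Q i)],
    Function.Injective (TensorProduct.piRightHom R R M Q)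

/-- `M` is `≤ κ`-presented: it has a presentation by at most `κ` generators and at most `κ`
relations, i.e. there is an exact sequence `R^(J) → R^(I) → M → 0` with `#I ≤ κ`, `#J ≤ κ`. -/
def IsPresentedLE (κ : Cardinal.{u}) : Prop :=
  ∃ (I J : Type u) (g : (J →₀ R) →ₗ[R] (I →₀ R)) (f : (I →₀ R) →ₗ[R] M),
    #I ≤ κ ∧ #J ≤ κ ∧ Function.Exact g f ∧ Function.Surjective f

/-- `M` is a transfinite extension of modules from the class `C` (a `C`-filtered module):
there are an ordinal `σ` and an increasing continuous chain `(F α | α ≤ σ)` of submodules from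
`0` to `M` all of whose consecutive factors are isomorphic to modules from `C`.
(The values of `F` at ordinals larger than `σ` are irrelevant.) -/
def IsTransfiniteExtension
    (C : ∀ (N : Type u) [AddCommGroup N] [Module R N], Prop) : Prop :=
  ∃ (σ : Ordinal.{u}) (F : Ordinal.{u} → Submodule R M),
    (∀ α β, α ≤ β → β ≤ σ → F α ≤ F β) ∧
    F 0 = ⊥ ∧
    (∀ α ≤ σ, Order.IsSuccLimit α → (F α : Set M) = ⋃ β : Set.Iio α, (F β : Set M)) ∧
    F σ = ⊤ ∧
    ∀ α < σ, ∃ (N : Type u) (_ : AddCommGroup N) (_ : Module R N), C N ∧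
      Nonempty ((F (Order.succ α) ⧸ (F α).submoduleOf (F (Order.succ α))) ≃ₗ[R] N)

/-- `M` is a `≤ κ`-presented flat Mittag-Leffler module. -/
def IsPresentedFlatMittagLeffler (κ : Cardinal.{u}) : Prop :=
  IsPresentedLE R M κ ∧ Module.Flat R M ∧ IsMittagLeffler R M

/-- `M` is a `κ`-restricted flat Mittag-Leffler module: a transfinite extension of
`≤ κ`-presented flat Mittag-Leffler modules. -/
def IsRestrictedFlatMittagLeffler (κ : Cardinal.{u}) : Prop :=
  IsTransfiniteExtension R M fun N _ _ => IsPresentedFlatMittagLeffler R N κ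

end Modules

/-- A property `P_R` of modules over a commutative ring `R`, for all `R`. -/
abbrev ModuleProperty : Type (u + 1) :=
  ∀ (R : Type u) [CommRing R] (M : Type u) [AddCommGroup M] [Module R M], Prop

/-- The property of being a `κ`-restricted flat Mittag-Leffler module. -/
def restrictedFlatMittagLeffler (κ : Cardinal.{u}) : ModuleProperty.{u} :=
  fun R _ M _ _ => IsRestrictedFlatMittagLeffler R M κ

/-- `P` ascends along the ring homomorphism `R → S`: base change to `S` preserves it. -/
def AscendsAlong (P : ModuleProperty.{u}) (R S : Type u) [CommRing R] [CommRing S]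
    [Algebra R S] : Prop :=
  ∀ (M : Type u) [AddCommGroup M] [Module R M], P R M → P S (S ⊗[R] M)

/-- `P` descends along the ring homomorphism `R → S`: base change to `S` reflects it. -/
def DescendsAlong (P : ModuleProperty.{u}) (R S : Type u) [CommRing R] [CommRing S]
    [Algebra R S] : Prop :=
  ∀ (M : Type u) [AddCommGroup M] [Module R M], P S (S ⊗[R] M) → P R M

/-- `P` is an ad-property: it ascends along all flat homomorphisms of commutative rings and
descends along all faithfully flat ones. -/
def IsADProperty (P : ModuleProperty.{u}) : Prop :=
  (∀ (R S : Type u) [CommRing R] [CommRing S] [Algebra R S],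
    Module.Flat R S → AscendsAlong P R S) ∧
  (∀ (R S : Type u) [CommRing R] [CommRing S] [Algebra R S],
    Module.FaithfullyFlat R S → DescendsAlong P R S)

section Schemes

open AlgebraicGeometry

variable {X : Scheme.{u}}

/-- The sheaf of modules `M` on `X` is quasi-coherent and for each affine open `U ⊆ X`
the `Γ(X, U)`-module `Γ(M, U)` has the property `P`. -/
def IsLocallyPQuasicoherent (P : ModuleProperty.{u}) (M : X.Modules) : Prop :=
  M.IsQuasicoherent ∧ ∀ U : X.affineOpens, P Γ(X, U) Γ(M, U)

/-- A `κ`-restricted Drinfeld vector bundle on a scheme. -/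
def IsRestrictedDrinfeldVectorBundle (κ : Cardinal.{u}) (M : X.Modules) : Prop :=
  IsLocallyPQuasicoherent (restrictedFlatMittagLeffler κ) M

end Schemes

end RestrictedML

/-! Ascent is direct: flat base change of a filtration is a filtration whose factors are the base
changes of the old ones. Descent is the substance, since a filtration of `S ⊗ M` need not come from
one of `M`. The Hill lemma (`IsRestrictedFlatMittagLeffler.exists_isHillFamily`) replaces the
filtration of `S ⊗ M` by a family `H` of submodules, closed under sums, with flat Mittag-Leffler
quotients and with enough `κ`-generated members `H₀`. A zigzag of length `ω`
(`exists_isGeneratedLE_baseChange_mem`) puts each element of `M` in a submodule `C` with `S ⊗ C ∈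
H₀`. If `A` is proper and `S ⊗ A ∈ H`, adding a `C` not contained in `A` produces the factor `(A +
C)/A`. It is `κ`-presented by descent, and flat Mittag-Leffler because it is pure in the flat
Mittag-Leffler module `M/A`. Transfinite iteration filters `M`.

Descent is proved for finite jointly faithfully flat families of algebras, which covers both a
single faithfully flat homomorphism and a cover of an affine open by basic opens. Locality follows
from the affine communication lemma, because the sections of a quasi-coherent sheaf over a basic
open are a localization. -/

namespace RestrictedML

/-! ### A common form of flatness and the Mittag-Leffler condition -/

section Reflects

variable {R : Type u} [CommRing R]

/-- Tensoring with `M` preserves the joint injectivity of the family `g`. -/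
def TensorReflects (M : Type u) [AddCommGroup M] [Module R M] {ι : Type u} {P : Type u}
    [AddCommGroup P] [Module R P] {Q : ι → Type u} [∀ i, AddCommGroup (Q i)]
    [∀ i, Module R (Q i)] (g : ∀ i, P →ₗ[R] Q i) : Prop :=
  ∀ x : M ⊗[R] P, (∀ i, (g i).lTensor M x = 0) → x = 0

variable {M N L : Type u} [AddCommGroup M] [Module R M] [AddCommGroup N] [Module R N]
  [AddCommGroup L] [Module R L]
  {ι : Type u} {P : Type u} [AddCommGroup P] [Module R P] {Q : ι → Type u}
  [∀ i, AddCommGroup (Q i)] [∀ i, Module R (Q i)] {g : ∀ i, P →ₗ[R] Q i}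

/-- Together with `isMittagLeffler_iff_tensorReflects`, this lets every closure property be proved
once for `TensorReflects` and then used for both conditions. -/
lemma flat_iff_tensorReflects : Module.Flat R M ↔
    ∀ (P Q : Type u) [AddCommGroup P] [Module R P] [AddCommGroup Q] [Module R Q]
      (f : P →ₗ[R] Q), Function.Injective f → TensorReflects M (fun _ : PUnit.{u + 1} => f) := by
  rw [Module.Flat.iff_lTensor_preserves_injective_linearMap]
  have key (P Q : Type u) [AddCommGroup P] [Module R P] [AddCommGroup Q] [Module R Q]
      (f : P →ₗ[R] Q) : Function.Injective (f.lTensor M) ↔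
        TensorReflects M (fun _ : PUnit.{u + 1} => f) := by
    rw [injective_iff_map_eq_zero]
    simp [TensorReflects]
  exact ⟨fun h P Q _ _ _ _ f hf => (key P Q f).mp (h f hf),
    fun h P Q _ _ _ _ f hf => (key P Q f).mpr (h P Q f hf)⟩

lemma piRightHom_apply (ι : Type u) (Q : ι → Type u) [∀ i, AddCommGroup (Q i)]
    [∀ i, Module R (Q i)] (x : M ⊗[R] (∀ i, Q i)) (i : ι) :
    TensorProduct.piRightHom R R M Q x i =
      (LinearMap.proj i : (∀ i, Q i) →ₗ[R] Q i).lTensor M x := by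
  induction x with
  | zero => simp
  | tmul x f => simp
  | add x y hx hy => simp [hx, hy]

lemma isMittagLeffler_iff_tensorReflects : IsMittagLeffler R M ↔
    ∀ (ι : Type u) (Q : ι → Type u) [∀ i, AddCommGroup (Q i)] [∀ i, Module R (Q i)],
      TensorReflects M (fun i => (LinearMap.proj i : (∀ i, Q i) →ₗ[R] Q i)) := by
  refine forall₄_congr fun ι Q _ _ => ?_
  rw [injective_iff_map_eq_zero]
  simp [TensorReflects, funext_iff, piRightHom_apply]

lemma TensorReflects.of_rTensor_injective (hN : TensorReflects N g) (f : M →ₗ[R] N)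
    (hf : Function.Injective (f.rTensor P)) : TensorReflects M g := by
  intro x hx
  refine (injective_iff_map_eq_zero _).mp hf x (hN _ fun i => ?_)
  rw [← LinearMap.comp_apply, LinearMap.lTensor_comp_rTensor, ← LinearMap.rTensor_comp_lTensor,
    LinearMap.comp_apply, hx, map_zero]

lemma TensorReflects.congr (hM : TensorReflects M g) (e : N ≃ₗ[R] M) : TensorReflects N g :=
  hM.of_rTensor_injective e.toLinearMap (e.rTensor P).injective

lemma TensorReflects.of_subsingleton [Subsingleton M] : TensorReflects M g :=
  fun _ _ => Subsingleton.elim _ _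

/-- Diagram chase: an element killed in all `N ⊗ Q i` dies in `L ⊗ P`, so it lifts to `M ⊗ P`.
Injectivity of `M ⊗ Q i → N ⊗ Q i` then kills the lift. Over `P` only right exactness is needed. -/
lemma TensorReflects.of_exact (hM : TensorReflects M g) (hL : TensorReflects L g) (f : M →ₗ[R] N)
    (h : N →ₗ[R] L) (hf : ∀ i, Function.Injective (f.rTensor (Q i))) (hfh : Function.Exact f h)
    (hh : Function.Surjective h) : TensorReflects N g := by
  intro x hx
  have hz : h.rTensor P x = 0 := hL _ fun i => by
    rw [← LinearMap.comp_apply, LinearMap.lTensor_comp_rTensor, ← LinearMap.rTensor_comp_lTensor,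
      LinearMap.comp_apply, hx, map_zero]
  obtain ⟨y, rfl⟩ := (rTensor_exact P hfh hh x).mp hz
  rw [hM y fun i => (injective_iff_map_eq_zero _).mp (hf i) _ ?_, map_zero]
  rw [← LinearMap.comp_apply, LinearMap.rTensor_comp_lTensor, ← LinearMap.lTensor_comp_rTensor,
    LinearMap.comp_apply, hx]

/-- If `B / A` is flat then `A ⊗ Q → B ⊗ Q` is injective. -/
lemma rTensor_inclusion_injective {A B : Submodule R M} (h : A ≤ B)
    [Module.Flat R (B ⧸ A.submoduleOf B)] (Q : Type u) [AddCommGroup Q] [Module R Q] :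
    Function.Injective ((Submodule.inclusion h).rTensor Q) := by
  rw [← LinearMap.lTensor_inj_iff_rTensor_inj]
  refine LinearMap.lTensor_injective_of_exact_of_flat _ (Submodule.mkQ_surjective
    (A.submoduleOf B)) _ (Submodule.inclusion_injective h) ?_ Q
  rw [LinearMap.exact_iff, Submodule.ker_mkQ, Submodule.range_inclusion]
  rfl

end Reflects

/-! ### Continuous chains with flat factors -/

section Chain

variable {R : Type u} [CommRing R] {M : Type u} [AddCommGroup M] [Module R M]

/-- An increasing continuous chain of submodules of `M`, indexed by ordinals up to `σ`. -/
structure IsContinuousChain (σ : Ordinal.{u}) (F : Ordinal.{u} → Submodule R M) : Prop where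
  mono : ∀ α β, α ≤ β → β ≤ σ → F α ≤ F β
  zero : F 0 = ⊥
  limit : ∀ α ≤ σ, Order.IsSuccLimit α → (F α : Set M) = ⋃ β : Set.Iio α, (F β : Set M)

variable {σ : Ordinal.{u}} {F : Ordinal.{u} → Submodule R M}

lemma IsContinuousChain.exists_le_of_fg (hF : IsContinuousChain σ F) {α : Ordinal.{u}}
    (hα : α ≤ σ) (hl : Order.IsSuccLimit α) {A : Submodule R M} (hA : A.FG) (hAF : A ≤ F α) :
    ∃ β < α, A ≤ F β := by
  classical
  obtain ⟨s, rfl⟩ := hA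
  rw [Submodule.span_le] at hAF
  simp only [Submodule.span_le]
  induction s using Finset.induction_on with
  | empty => exact ⟨0, by simpa using hl.bot_lt, by simp⟩
  | insert a s ha ih =>
    simp only [Finset.coe_insert, Set.insert_subset_iff] at hAF ⊢
    obtain ⟨β, hβ, hsβ⟩ := ih hAF.2
    have := hAF.1
    rw [hF.limit α hα hl] at this
    obtain ⟨⟨γ, hγ⟩, hγ'⟩ := Set.mem_iUnion.mp this
    refine ⟨max β γ, max_lt hβ hγ, hF.mono γ _ (le_max_right _ _) ?_ hγ', hsβ.trans ?_⟩
    · exact (max_lt hβ hγ).le.trans hα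
    · exact hF.mono β _ (le_max_left _ _) ((max_lt hβ hγ).le.trans hα)

lemma IsContinuousChain.exists_rTensor (hF : IsContinuousChain σ F) {α : Ordinal.{u}}
    (hα : α ≤ σ) (hl : Order.IsSuccLimit α) {P : Type u} [AddCommGroup P] [Module R P]
    (x : F α ⊗[R] P) : ∃ (β : Ordinal.{u}) (hβ : β < α) (y : F β ⊗[R] P),
      (Submodule.inclusion (hF.mono β α hβ.le hα)).rTensor P y = x := by
  obtain ⟨J, hJ, hJF, y, rfl⟩ := Submodule.exists_fg_le_eq_rTensor_inclusion x
  obtain ⟨β, hβ, hJβ⟩ := hF.exists_le_of_fg hα hl hJ hJF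
  refine ⟨β, hβ, (Submodule.inclusion hJβ).rTensor P y, ?_⟩
  rw [← LinearMap.rTensor_comp_apply]
  rfl

/-- In a continuous chain with flat factors, all inclusions are pure. -/
lemma IsContinuousChain.rTensor_injective (hF : IsContinuousChain σ F)
    (hflat : ∀ α < σ, Module.Flat R (F (Order.succ α) ⧸ (F α).submoduleOf (F (Order.succ α))))
    (Q : Type u) [AddCommGroup Q] [Module R Q] {α β : Ordinal.{u}} (hαβ : α ≤ β) (hβ : β ≤ σ) :
    Function.Injective ((Submodule.inclusion (hF.mono α β hαβ hβ)).rTensor Q) := by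
  induction β using SuccOrder.limitRecOn with
  | isMin β hmin =>
    obtain rfl := hmin.eq_of_le hαβ
    have : Submodule.inclusion (hF.mono _ _ hαβ hβ) = LinearMap.id := rfl
    rw [this, LinearMap.rTensor_id]; exact Function.injective_id
  | succ β _ ih =>
    rcases hαβ.eq_or_lt with rfl | hlt
    · have : Submodule.inclusion (hF.mono _ _ hαβ hβ) = LinearMap.id := rfl
      rw [this, LinearMap.rTensor_id]; exact Function.injective_id
    · have hαβ' := Order.lt_succ_iff.mp hlt
      have hβ' : β < σ := (Order.lt_succ β).trans_le hβ
      have := hflat β hβ'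
      have h1 := rTensor_inclusion_injective (hF.mono β _ (Order.le_succ β) hβ) Q
      have := h1.comp (ih hαβ' hβ'.le)
      rwa [← LinearMap.coe_comp, ← LinearMap.rTensor_comp] at this
  | isSuccLimit β hl ih =>
    rcases hαβ.eq_or_lt with rfl | hlt
    · have : Submodule.inclusion (hF.mono _ _ hαβ hβ) = LinearMap.id := rfl
      rw [this, LinearMap.rTensor_id]; exact Function.injective_id
    rw [injective_iff_map_eq_zero]
    intro x hx
    obtain ⟨J, hJ, y, rfl⟩ := Submodule.exists_fg_le_eq_rTensor_subtype x
    let i := Submodule.inclusion (hF.mono α β hαβ hβ)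
    have h0 : (J.map i).subtype.rTensor Q ((i.submoduleMap J).rTensor Q y) =
        (J.map i).subtype.rTensor Q 0 := by
      rw [map_zero, ← hx, ← LinearMap.rTensor_comp_apply, ← LinearMap.rTensor_comp_apply]
      rfl
    -- An element that vanishes in `F β ⊗ Q` already vanishes over a finitely generated submodule of
    -- `F β`, hence at some stage `γ < β`. Taking `max α γ` keeps the stage above `α`, where
    -- induction applies.
    obtain ⟨N, hN, hle, h1⟩ := (hJ.map i).exists_rTensor_fg_inclusion_eq h0
    obtain ⟨γ, hγ, hNγ⟩ := hF.exists_le_of_fg hβ hl (hN.map (F β).subtype)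
      (Submodule.map_subtype_le _ _)
    have hm : max α γ < β := max_lt hlt hγ
    have hNm : N.map (F β).subtype ≤ F (max α γ) :=
      hNγ.trans (hF.mono _ _ (le_max_right _ _) (hm.le.trans hβ))
    refine (injective_iff_map_eq_zero _).mp (ih _ hm (le_max_left _ _) (hm.le.trans hβ)) _ ?_
    have h2 := congrArg ((Submodule.inclusion hNm ∘ₗ (F β).subtype.submoduleMap N).rTensor Q) h1
    rw [map_zero, map_zero, ← LinearMap.rTensor_comp_apply, ← LinearMap.rTensor_comp_apply] at h2
    rw [← LinearMap.rTensor_comp_apply, ← h2]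
    rfl

lemma IsContinuousChain.tensorReflects (hF : IsContinuousChain σ F)
    (hflat : ∀ α < σ, Module.Flat R (F (Order.succ α) ⧸ (F α).submoduleOf (F (Order.succ α))))
    {ι : Type u} {P : Type u} [AddCommGroup P] [Module R P] {Q : ι → Type u}
    [∀ i, AddCommGroup (Q i)] [∀ i, Module R (Q i)] {g : ∀ i, P →ₗ[R] Q i}
    (hg : ∀ α < σ, TensorReflects (F (Order.succ α) ⧸ (F α).submoduleOf (F (Order.succ α))) g)
    {β : Ordinal.{u}} (hβ : β ≤ σ) : TensorReflects (F β) g := by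
  induction β using SuccOrder.limitRecOn with
  | isMin β hmin =>
    rw [hmin.eq_bot, Ordinal.bot_eq_zero, hF.zero]
    exact .of_subsingleton
  | succ β _ ih =>
    have hβ' : β < σ := (Order.lt_succ β).trans_le hβ
    refine (ih hβ'.le).of_exact (hg β hβ') (Submodule.inclusion (hF.mono β _ (Order.le_succ β) hβ))
      (Submodule.mkQ _) (fun i => hF.rTensor_injective hflat _ (Order.le_succ β) hβ) ?_
      (Submodule.mkQ_surjective _)
    rw [LinearMap.exact_iff, Submodule.ker_mkQ, Submodule.range_inclusion]
    rfl
  | isSuccLimit β hl ih =>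
    intro x hx
    obtain ⟨γ, hγ, y, rfl⟩ := hF.exists_rTensor hβ hl x
    rw [ih γ hγ (hγ.le.trans hβ) y fun i => ?_, map_zero]
    refine (injective_iff_map_eq_zero _).mp (hF.rTensor_injective hflat (Q i) hγ.le hβ) _ ?_
    rw [← LinearMap.comp_apply, LinearMap.rTensor_comp_lTensor, ← LinearMap.lTensor_comp_rTensor,
      LinearMap.comp_apply, hx]

end Chain

/-! ### Flat Mittag-Leffler modules: pure submodules and transfinite extensions -/

section FlatMittagLeffler

variable {R : Type u} [CommRing R] {M N : Type u} [AddCommGroup M] [Module R M]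
  [AddCommGroup N] [Module R N]

variable (R M) in
/-- `M` is a flat Mittag-Leffler module. -/
def IsFlatMittagLeffler : Prop := Module.Flat R M ∧ IsMittagLeffler R M

lemma IsFlatMittagLeffler.congr (h : IsFlatMittagLeffler R M) (e : N ≃ₗ[R] M) :
    IsFlatMittagLeffler R N :=
  ⟨have := h.1; .of_linearEquiv e,
    isMittagLeffler_iff_tensorReflects.mpr fun ι Q _ _ =>
      (isMittagLeffler_iff_tensorReflects.mp h.2 ι Q).congr e⟩

lemma IsFlatMittagLeffler.of_subsingleton [Subsingleton M] : IsFlatMittagLeffler R M :=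
  ⟨flat_iff_tensorReflects.mpr fun _ _ _ _ _ _ _ _ => .of_subsingleton,
    isMittagLeffler_iff_tensorReflects.mpr fun _ _ _ _ => .of_subsingleton⟩

/-- Flatness of the quotient makes `A` pure in `M`, and both conditions pass to pure submodules. -/
lemma IsFlatMittagLeffler.submodule (h : IsFlatMittagLeffler R M) (A : Submodule R M)
    [Module.Flat R (M ⧸ A)] : IsFlatMittagLeffler R A := by
  have key (P : Type u) [AddCommGroup P] [Module R P] :
      Function.Injective (A.subtype.rTensor P) := by
    rw [← LinearMap.lTensor_inj_iff_rTensor_inj]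
    refine LinearMap.lTensor_injective_of_exact_of_flat _ A.mkQ_surjective _
      A.injective_subtype ?_ P
    rw [LinearMap.exact_iff, Submodule.ker_mkQ, Submodule.range_subtype]
  exact ⟨flat_iff_tensorReflects.mpr fun P Q _ _ _ _ f hf =>
      (flat_iff_tensorReflects.mp h.1 P Q f hf).of_rTensor_injective _ (key P),
    isMittagLeffler_iff_tensorReflects.mpr fun ι Q _ _ =>
      (isMittagLeffler_iff_tensorReflects.mp h.2 ι Q).of_rTensor_injective _ (key _)⟩

/-- Transfinite extensions of flat Mittag-Leffler modules are flat Mittag-Leffler. -/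
lemma IsContinuousChain.isFlatMittagLeffler {σ : Ordinal.{u}} {F : Ordinal.{u} → Submodule R M}
    (hF : IsContinuousChain σ F) (htop : F σ = ⊤)
    (h : ∀ α < σ, IsFlatMittagLeffler R
      (F (Order.succ α) ⧸ (F α).submoduleOf (F (Order.succ α)))) :
    IsFlatMittagLeffler R M := by
  let e : M ≃ₗ[R] F σ := (LinearEquiv.ofTop _ htop).symm
  have hfl := fun α hα => (h α hα).1
  exact ⟨flat_iff_tensorReflects.mpr fun P Q _ _ _ _ f hf =>
      (hF.tensorReflects hfl (fun α hα => flat_iff_tensorReflects.mp (h α hα).1 P Q f hf)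
        le_rfl).congr e,
    isMittagLeffler_iff_tensorReflects.mpr fun ι Q _ _ =>
      (hF.tensorReflects hfl (fun α hα => isMittagLeffler_iff_tensorReflects.mp (h α hα).2 ι Q)
        le_rfl).congr e⟩

end FlatMittagLeffler

/-! ### Submodules with at most `κ` generators -/

section Generated

variable {R : Type u} [CommRing R] {M N : Type u} [AddCommGroup M] [Module R M]
  [AddCommGroup N] [Module R N] {κ : Cardinal.{u}}

/-- The submodule `A` has a generating set of cardinality at most `κ`. -/
def IsGeneratedLE (κ : Cardinal.{u}) (A : Submodule R M) : Prop :=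
  ∃ s : Set M, #s ≤ κ ∧ Submodule.span R s = A

lemma IsGeneratedLE.map {A : Submodule R M} (hA : IsGeneratedLE κ A) (f : M →ₗ[R] N) :
    IsGeneratedLE κ (A.map f) := by
  obtain ⟨s, hs, rfl⟩ := hA
  exact ⟨f '' s, Cardinal.mk_image_le.trans hs, (Submodule.map_span f s).symm⟩

lemma IsGeneratedLE.top {A : Submodule R M} (hA : IsGeneratedLE κ A) :
    IsGeneratedLE κ (⊤ : Submodule R A) := by
  obtain ⟨s, hs, rfl⟩ := hA
  refine ⟨(↑) ⁻¹' s, (Cardinal.mk_preimage_of_injective _ _ Subtype.val_injective).trans hs, ?_⟩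
  exact Submodule.span_span_coe_preimage

lemma isGeneratedLE_iSup (hκ : ℵ₀ ≤ κ) {ι : Type u} (hι : #ι ≤ κ) {A : ι → Submodule R M}
    (hA : ∀ i, IsGeneratedLE κ (A i)) : IsGeneratedLE κ (⨆ i, A i) := by
  choose s hs hsA using hA
  refine ⟨⋃ i, s i, ?_, by simp_rw [Submodule.span_iUnion, hsA]⟩
  refine (Cardinal.mk_iUnion_le s).trans ((mul_le_mul' hι (ciSup_le' hs)).trans ?_)
  rw [Cardinal.mul_eq_self hκ]

lemma isGeneratedLE_span (s : Set M) (hs : #s ≤ κ) : IsGeneratedLE κ (Submodule.span R s) :=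
  ⟨s, hs, rfl⟩

lemma isGeneratedLE_of_finite (hκ : ℵ₀ ≤ κ) {s : Set M} (hs : s.Finite) :
    IsGeneratedLE κ (Submodule.span R s) :=
  ⟨s, (Cardinal.lt_aleph0_iff_set_finite.mpr hs).le.trans hκ, rfl⟩

lemma IsGeneratedLE.sup (hκ : ℵ₀ ≤ κ) {A B : Submodule R M} (hA : IsGeneratedLE κ A)
    (hB : IsGeneratedLE κ B) : IsGeneratedLE κ (A ⊔ B) := by
  obtain ⟨s, hs, rfl⟩ := hA
  obtain ⟨t, ht, rfl⟩ := hB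
  refine ⟨s ∪ t, (Cardinal.mk_union_le _ _).trans ?_, Submodule.span_union _ _⟩
  exact (add_le_add hs ht).trans (Cardinal.add_eq_self hκ).le

lemma IsGeneratedLE.baseChange {A : Submodule R M} (hA : IsGeneratedLE κ A) (S : Type u)
    [CommRing S] [Algebra R S] : IsGeneratedLE κ (A.baseChange S) := by
  obtain ⟨s, hs, rfl⟩ := hA
  exact ⟨_, Cardinal.mk_image_le.trans hs, (Submodule.baseChange_span S s).symm⟩

lemma isGeneratedLE_top_finsupp {I : Type u} (hI : #I ≤ κ) :
    IsGeneratedLE κ (⊤ : Submodule R (I →₀ R)) := by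
  refine ⟨Set.range fun i => Finsupp.single i 1, Cardinal.mk_range_le.trans hI, ?_⟩
  simpa using (Finsupp.basisSingleOne (R := R) (ι := I)).span_eq

end Generated

/-! ### Modules with at most `κ` generators and relations -/

section Presented

variable {R : Type u} [CommRing R] {M N : Type u} [AddCommGroup M] [Module R M]
  [AddCommGroup N] [Module R N] {κ : Cardinal.{u}}

lemma isPresentedLE_iff : IsPresentedLE R M κ ↔ ∃ (I : Type u) (f : (I →₀ R) →ₗ[R] M),
    #I ≤ κ ∧ Function.Surjective f ∧ IsGeneratedLE κ (LinearMap.ker f) := by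
  constructor
  · rintro ⟨I, J, g, f, hI, hJ, hgf, hf⟩
    refine ⟨I, f, hI, hf, ?_⟩
    rw [LinearMap.exact_iff.mp hgf, LinearMap.range_eq_map]
    exact (isGeneratedLE_top_finsupp hJ).map g
  · rintro ⟨I, f, hI, hf, s, hs, hsf⟩
    refine ⟨I, s, Finsupp.linearCombination R (↑), f, hI, hs, ?_, hf⟩
    rw [LinearMap.exact_iff, Finsupp.range_linearCombination, ← hsf, Subtype.range_coe]

lemma IsPresentedLE.congr (h : IsPresentedLE R M κ) (e : M ≃ₗ[R] N) : IsPresentedLE R N κ := by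
  obtain ⟨I, f, hI, hf, hs⟩ := isPresentedLE_iff.mp h
  refine isPresentedLE_iff.mpr ⟨I, e.toLinearMap ∘ₗ f, hI, e.surjective.comp hf, ?_⟩
  rwa [LinearEquiv.ker_comp]

lemma IsPresentedLE.isGeneratedLE_top (h : IsPresentedLE R M κ) :
    IsGeneratedLE κ (⊤ : Submodule R M) := by
  obtain ⟨I, f, hI, hf, hs⟩ := isPresentedLE_iff.mp h
  rw [← LinearMap.range_eq_top.mpr hf, LinearMap.range_eq_map]
  exact (isGeneratedLE_top_finsupp hI).map f

/-- The kernel of a surjection from a `κ`-generated module onto a `κ`-presented one is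
`κ`-generated. -/
lemma IsPresentedLE.isGeneratedLE_ker (hκ : ℵ₀ ≤ κ) (h : IsPresentedLE R M κ)
    (hN : IsGeneratedLE κ (⊤ : Submodule R N)) (f : N →ₗ[R] M) (hf : Function.Surjective f) :
    IsGeneratedLE κ (LinearMap.ker f) := by
  obtain ⟨I, p, hI, hp, hker⟩ := isPresentedLE_iff.mp h
  obtain ⟨s, hs, hst⟩ := hN
  obtain ⟨q, rfl⟩ := Module.projective_lifting_property f p hf
  choose y hy using fun x : N => hp (f x)
  -- The kernel is the image under `q` of the relations of the presentation, plus the errors made in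
  -- replacing each generator `x` of `N` by an element of the range of `q` with the same image in
  -- `M`.
  set T : Submodule R N := Submodule.span R ((fun x => x - q (y x)) '' s) with hT
  have hTk : T ≤ LinearMap.ker f := by
    rw [hT, Submodule.span_le]
    rintro _ ⟨x, _, rfl⟩
    have := hy x
    simp only [LinearMap.coe_comp, Function.comp_apply] at this
    simp [this]
  have hKk : (LinearMap.ker (f ∘ₗ q)).map q ≤ LinearMap.ker f := by
    rw [Submodule.map_le_iff_le_comap, LinearMap.ker_comp]
  have htop : LinearMap.range q ⊔ T = ⊤ := by
    rw [eq_top_iff, ← hst, Submodule.span_le]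
    intro x hx
    exact Submodule.mem_sup.mpr ⟨q (y x), ⟨_, rfl⟩, x - q (y x),
      Submodule.subset_span ⟨x, hx, rfl⟩, by abel⟩
  have : LinearMap.ker f = (LinearMap.ker (f ∘ₗ q)).map q ⊔ T := by
    refine le_antisymm (fun z hz => ?_) (sup_le hKk hTk)
    obtain ⟨_, ⟨w, rfl⟩, t, ht, rfl⟩ := Submodule.mem_sup.mp (htop ▸ Submodule.mem_top : z ∈ _)
    refine Submodule.mem_sup.mpr ⟨q w, ⟨w, ?_, rfl⟩, t, ht, rfl⟩
    have h1 : f t = 0 := hTk ht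
    simpa [h1] using hz
  rw [this]
  exact (hker.map q).sup hκ (isGeneratedLE_span _ (Cardinal.mk_image_le.trans hs))

/-- Right exactness suffices, with no flatness, because `Submodule.baseChange` is the image in `S ⊗
N`. -/
lemma ker_baseChange {S : Type u} [CommRing S] [Algebra R S] (p : N →ₗ[R] M)
    (hp : Function.Surjective p) :
    LinearMap.ker (p.baseChange S) = (LinearMap.ker p).baseChange S := by
  ext x
  exact lTensor_exact S (f := (LinearMap.ker p).subtype) (g := p)
    (by rw [LinearMap.exact_iff, Submodule.range_subtype]) hp x

lemma IsPresentedLE.baseChange (h : IsPresentedLE R M κ) (S : Type u) [CommRing S]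
    [Algebra R S] : IsPresentedLE S (S ⊗[R] M) κ := by
  classical
  obtain ⟨I, p, hI, hp, hker⟩ := isPresentedLE_iff.mp h
  let e : S ⊗[R] (I →₀ R) ≃ₗ[S] (I →₀ S) := TensorProduct.finsuppScalarRight R S S I
  refine isPresentedLE_iff.mpr ⟨I, p.baseChange S ∘ₗ e.symm.toLinearMap, hI,
    (LinearMap.lTensor_surjective S hp).comp e.symm.surjective, ?_⟩
  have : LinearMap.ker (p.baseChange S ∘ₗ e.symm.toLinearMap) =
      ((LinearMap.ker p).baseChange S).map e.toLinearMap := by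
    rw [LinearMap.ker_comp, ker_baseChange p hp]
    exact (Submodule.map_equiv_eq_comap_symm e _).symm
  rw [this]
  exact (hker.baseChange S).map _

/-- A module filtered by at most `κ` factors that are `κ`-presented is `κ`-presented. -/
lemma isPresentedLE_iSup (hκ : ℵ₀ ≤ κ) {U : Type u} [LinearOrder U] [WellFoundedLT U]
    (hU : #U ≤ κ) (A : U → Submodule R M) (hA : ∀ α, IsGeneratedLE κ (A α))
    (hp : ∀ α, IsPresentedLE R (A α ⧸ (⨆ β : Set.Iio α, A β).submoduleOf (A α)) κ) :
    IsPresentedLE R (⨆ α, A α : Submodule R M) κ := by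
  choose s hs hsA using hA
  let I := Σ α, s α
  have hI : #I ≤ κ := by
    rw [Cardinal.mk_sigma]
    refine (Cardinal.sum_le_mk_mul_iSup _).trans ((mul_le_mul' hU (ciSup_le' hs)).trans ?_)
    rw [Cardinal.mul_eq_self hκ]
  let f : (I →₀ R) →ₗ[R] M := Finsupp.linearCombination R fun i => (i.2 : M)
  -- The free module on all the generators is graded by the level `α`: `X α` is the part at level
  -- `α`, and `Y α` the part at lower levels.
  let X (α : U) : Submodule R (I →₀ R) := Finsupp.supported R R {i | i.1 = α}
  let Y (α : U) : Submodule R (I →₀ R) := Finsupp.supported R R {i | i.1 < α}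
  have hX (α) : (X α).map f = A α := by
    rw [← Finsupp.span_image_eq_map_linearCombination, ← hsA]
    congr 1
    ext x
    constructor
    · rintro ⟨⟨_, y⟩, rfl, rfl⟩
      exact y.2
    · intro hx
      exact ⟨⟨α, x, hx⟩, rfl, rfl⟩
  have hXg (α) : IsGeneratedLE κ (X α) := by
    refine ⟨(fun i => Finsupp.single i 1) '' {i : I | i.1 = α}, Cardinal.mk_image_le.trans
      ((Cardinal.mk_set_le _).trans hI), (Finsupp.supported_eq_span_single R _).symm⟩
  have hY (α) : (Y α).map f = ⨆ β : Set.Iio α, A β := by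
    rw [← Finsupp.span_image_eq_map_linearCombination]
    simp_rw [← hsA, ← Submodule.span_iUnion]
    congr 1
    ext x
    simp only [Set.mem_image, Set.mem_iUnion]
    constructor
    · rintro ⟨⟨β, y⟩, h, rfl⟩
      exact ⟨⟨β, h⟩, y.2⟩
    · rintro ⟨⟨β, h⟩, hx⟩
      exact ⟨⟨β, x, hx⟩, h, rfl⟩
  -- This is the kernel of the surjection from `X α` to the `α`-th factor, which is `κ`-presented.
  -- Its elements are the leading parts of relations at level `α`.
  have hK (α) : IsGeneratedLE κ (X α ⊓ (⨆ β : Set.Iio α, A β).comap f) := by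
    have hle : X α ≤ (A α).comap f := Submodule.map_le_iff_le_comap.mp (hX α).le
    let φ : X α →ₗ[R] (A α ⧸ (⨆ β : Set.Iio α, A β).submoduleOf (A α)) :=
      Submodule.mkQ _ ∘ₗ f.restrict hle
    have hφ : Function.Surjective φ := by
      refine (Submodule.mkQ_surjective _).comp ?_
      rintro ⟨x, hx⟩
      rw [← hX] at hx
      obtain ⟨y, hy, rfl⟩ := hx
      exact ⟨⟨y, hy⟩, rfl⟩
    have := ((hp α).isGeneratedLE_ker hκ (hXg α).top φ hφ).map (X α).subtype
    convert! this using 1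
    ext x
    simp only [Submodule.mem_inf, Submodule.mem_comap, Submodule.mem_map, LinearMap.mem_ker]
    constructor
    · rintro ⟨h1, h2⟩
      exact ⟨⟨x, h1⟩, (Submodule.Quotient.mk_eq_zero _).mpr h2, rfl⟩
    · rintro ⟨y, hy, rfl⟩
      have hy' : f.restrict hle y ∈ (⨆ β : Set.Iio α, A β).submoduleOf (A α) :=
        (Submodule.Quotient.mk_eq_zero _).mp hy
      exact ⟨y.2, hy'⟩
  choose r hr hrK using hK
  have hw (α) (z : r α) : ∃ w ∈ Y α, f w = f z := by
    have : (z : I →₀ R) ∈ X α ⊓ (⨆ β : Set.Iio α, A β).comap f :=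
      (hrK α) ▸ Submodule.subset_span z.2
    have h2 : f z ∈ ⨆ β : Set.Iio α, A β := this.2
    rw [← hY] at h2
    exact h2
  choose w hwY hwf using hw
  -- Each leading part `z` is completed to a true relation `z - w α z` by a correction at lower
  -- levels.
  let L : Submodule R (I →₀ R) :=
    ⨆ α, Submodule.span R (Set.range fun z : r α => (z : I →₀ R) - w α z)
  have hLg : IsGeneratedLE κ L :=
    isGeneratedLE_iSup hκ hU fun α => isGeneratedLE_span _ (Cardinal.mk_range_le.trans (hr α))
  have hLf : L ≤ LinearMap.ker f := by
    refine iSup_le fun α => Submodule.span_le.mpr ?_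
    rintro _ ⟨z, rfl⟩
    simp [hwf]
  have hXL (α) : X α ⊓ (⨆ β : Set.Iio α, A β).comap f ≤ L ⊔ Y α := by
    rw [← hrK, Submodule.span_le]
    intro z hz
    refine Submodule.mem_sup.mpr ⟨z - w α ⟨z, hz⟩, ?_, w α ⟨z, hz⟩, hwY _ _, by abel⟩
    exact Submodule.mem_iSup_of_mem α (Submodule.subset_span ⟨⟨z, hz⟩, rfl⟩)
  have hbound (x : I →₀ R) (hx : x ≠ 0) : ∃ β, x ∈ X β ⊔ Y β ∧
      ∀ α, x ∈ Y α → β < α := by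
    classical
    have hne : (x.support.image Sigma.fst).Nonempty := by simpa using hx
    refine ⟨(x.support.image Sigma.fst).max' hne, ?_, fun α hα => ?_⟩
    · rw [← Finsupp.supported_union, Finsupp.mem_supported]
      intro i hi
      have := Finset.le_max' (x.support.image Sigma.fst) i.1 (Finset.mem_image_of_mem _ hi)
      exact this.eq_or_lt
    · obtain ⟨i, hi, hi'⟩ := Finset.mem_image.mp (Finset.max'_mem _ hne)
      rw [← hi']
      exact (Finsupp.mem_supported R x).mp hα hi
  -- Subtracting an element of `L` cancels the leading part of a relation, so its top level drops.
  -- Well-foundedness ends the reduction.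
  have hker : ∀ α, ∀ x ∈ X α ⊔ Y α, f x = 0 → x ∈ L := by
    intro α
    induction α using WellFoundedLT.induction with
    | ind α ih =>
    intro x hx hfx
    obtain ⟨a, ha, b, hb, rfl⟩ := Submodule.mem_sup.mp hx
    have : a ∈ L ⊔ Y α := by
      refine hXL α ⟨ha, ?_⟩
      change f a ∈ ⨆ β : Set.Iio α, A β
      rw [← hY, eq_neg_of_add_eq_zero_left ((map_add f a b).symm.trans hfx),
        ← map_neg]
      exact ⟨_, neg_mem hb, rfl⟩
    obtain ⟨l, hl, c, hc, rfl⟩ := Submodule.mem_sup.mp this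
    rw [add_assoc]
    refine add_mem hl ?_
    by_cases h0 : c + b = 0
    · rw [h0]; exact zero_mem _
    obtain ⟨β, hβ, hβ'⟩ := hbound _ h0
    refine ih β (hβ' α (add_mem hc hb)) _ hβ ?_
    rw [add_assoc, map_add, LinearMap.mem_ker.mp (hLf hl), zero_add] at hfx
    exact hfx
  have hkerf : LinearMap.ker f = L := by
    refine le_antisymm (fun x hx => ?_) hLf
    by_cases h0 : x = 0
    · rw [h0]; exact zero_mem _
    obtain ⟨β, hβ, -⟩ := hbound x h0
    exact hker β x hβ hx
  have hrange : LinearMap.range f = ⨆ α, A α := by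
    rw [Finsupp.range_linearCombination]
    simp_rw [← hsA, ← Submodule.span_iUnion]
    congr 1
    ext x
    simp only [Set.mem_range, Set.mem_iUnion]
    constructor
    · rintro ⟨⟨α, y⟩, rfl⟩
      exact ⟨α, y.2⟩
    · rintro ⟨α, hx⟩
      exact ⟨⟨α, x, hx⟩, rfl⟩
  have : IsPresentedLE R (LinearMap.range f) κ := isPresentedLE_iff.mpr ⟨I, f.rangeRestrict, hI,
    f.surjective_rangeRestrict, by rwa [LinearMap.ker_rangeRestrict, hkerf]⟩
  exact this.congr (LinearEquiv.ofEq _ _ hrange)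

end Presented

/-! ### Comparison of subquotients -/

section Quotients

variable {R : Type u} [CommRing R] {M N : Type u} [AddCommGroup M] [Module R M]
  [AddCommGroup N] [Module R N]

/-- A second isomorphism theorem: if `B` is `C` enlarged by the image of `A`, and `q` induces an
injection `A / (A ∩ D) → N / C`, then `A / (A ∩ D) ≃ B / (B ∩ C)`. -/
lemma nonempty_quotient_submoduleOf_equiv (q : M →ₗ[R] N) (A D : Submodule R M)
    (B C : Submodule R N) (hAB : A.map q ≤ B) (hB : B ≤ A.map q ⊔ C)
    (h : ∀ a ∈ A, q a ∈ C ↔ a ∈ D) :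
    Nonempty ((A ⧸ D.submoduleOf A) ≃ₗ[R] (B ⧸ C.submoduleOf B)) := by
  let φ : A →ₗ[R] (B ⧸ C.submoduleOf B) :=
    Submodule.mkQ _ ∘ₗ q.restrict (Submodule.map_le_iff_le_comap.mp hAB)
  have hφ : Function.Surjective φ := by
    intro y
    obtain ⟨⟨b, hb⟩, rfl⟩ := Submodule.mkQ_surjective _ y
    obtain ⟨_, ⟨a, ha, rfl⟩, c, hc, hac⟩ := Submodule.mem_sup.mp (hB hb)
    refine ⟨⟨a, ha⟩, (Submodule.Quotient.eq _).mpr ?_⟩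
    change q a - b ∈ C
    rw [← hac, sub_add_cancel_left]
    exact neg_mem hc
  have hk : LinearMap.ker φ = D.submoduleOf A := by
    ext ⟨a, ha⟩
    rw [LinearMap.mem_ker]
    refine (Submodule.Quotient.mk_eq_zero _).trans ?_
    exact h a ha
  exact ⟨(Submodule.quotEquivOfEq _ _ hk.symm).trans (φ.quotKerEquivOfSurjective hφ)⟩

lemma nonempty_map_mkQ_equiv {A B : Submodule R M} :
    Nonempty ((B ⧸ A.submoduleOf B) ≃ₗ[R] B.map A.mkQ) := by
  obtain ⟨e⟩ := nonempty_quotient_submoduleOf_equiv A.mkQ B A (B.map A.mkQ) ⊥ le_rfl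
    (by simp) (by simp)
  exact ⟨e.trans (Submodule.quotEquivOfEqBot _ (by simp [Submodule.submoduleOf]))⟩

/-- If `B / A` is `κ`-generated, then `B = A + C` with `C` a `κ`-generated submodule. -/
lemma exists_isGeneratedLE_sup_eq {κ : Cardinal.{u}} {A B : Submodule R M} (h : A ≤ B)
    (hg : IsGeneratedLE κ (⊤ : Submodule R (B ⧸ A.submoduleOf B))) :
    ∃ C : Submodule R M, IsGeneratedLE κ C ∧ A ⊔ C = B := by
  obtain ⟨t, ht, htop⟩ := hg
  let r : (B ⧸ A.submoduleOf B) → M := fun x => (Function.surjInv (Submodule.mkQ_surjective _) x : B)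
  refine ⟨Submodule.span R (r '' t), isGeneratedLE_span _ (Cardinal.mk_image_le.trans ht), ?_⟩
  have hle : Submodule.span R (r '' t) ≤ B := by
    rw [Submodule.span_le]
    rintro _ ⟨x, -, rfl⟩
    exact Subtype.property _
  refine le_antisymm (sup_le h hle) fun b hb => ?_
  have key : (⊤ : Submodule R (B ⧸ A.submoduleOf B)) ≤
      ((A ⊔ Submodule.span R (r '' t)).submoduleOf B).map (Submodule.mkQ _) := by
    rw [← htop, Submodule.span_le]
    intro x hx
    exact ⟨Function.surjInv (Submodule.mkQ_surjective _) x,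
      Submodule.mem_sup_right (Submodule.subset_span ⟨x, hx, rfl⟩),
      Function.surjInv_eq (Submodule.mkQ_surjective _) x⟩
  obtain ⟨c, hc, hcb⟩ := key (Submodule.mem_top : Submodule.Quotient.mk ⟨b, hb⟩ ∈ _)
  have h1 : (c : M) - b ∈ A :=
    ((Submodule.Quotient.eq (A.submoduleOf B)).mp hcb : c - ⟨b, hb⟩ ∈ A.submoduleOf B)
  have h2 : (c : M) ∈ A ⊔ Submodule.span R (r '' t) := hc
  have := sub_mem h2 (Submodule.mem_sup_left (T := Submodule.span R (r '' t)) h1)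
  simpa using this

end Quotients

/-! ### Closed index sets for the Hill lemma -/

section Hill

variable {R : Type u} [CommRing R] {M : Type u} [AddCommGroup M] [Module R M]
  {U : Type u} (A : U → Submodule R M)

/-- The sum of the submodules `A i` for `i ∈ T`. -/
def sumOn (T : Set U) : Submodule R M := ⨆ i ∈ T, A i

variable {A}

lemma le_sumOn {T : Set U} {i : U} (hi : i ∈ T) : A i ≤ sumOn A T := le_biSup A hi

lemma sumOn_mono {T T' : Set U} (h : T ⊆ T') : sumOn A T ≤ sumOn A T' := biSup_mono h

lemma mem_sumOn_of_subset {T T' : Set U} {x : M} (hx : x ∈ sumOn A T) (h : T ⊆ T') :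
    x ∈ sumOn A T' := sumOn_mono h hx

lemma sumOn_union (T T' : Set U) : sumOn A (T ∪ T') = sumOn A T ⊔ sumOn A T' := iSup_union

lemma sumOn_iUnion {ι : Sort*} (T : ι → Set U) : sumOn A (⋃ k, T k) = ⨆ k, sumOn A (T k) :=
  iSup_iUnion _ _

lemma sumOn_le {T : Set U} {B : Submodule R M} (h : ∀ i ∈ T, A i ≤ B) : sumOn A T ≤ B :=
  iSup₂_le h

lemma sumOn_singleton (i : U) : sumOn A {i} = A i := iSup_singleton

lemma exists_finset_of_mem_sumOn {T : Set U} {x : M} (hx : x ∈ sumOn A T) :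
    ∃ t : Finset U, (t : Set U) ⊆ T ∧ x ∈ sumOn A (t : Set U) := by
  classical
  rw [sumOn, iSup_subtype'] at hx
  obtain ⟨s, hs⟩ := Submodule.exists_finset_of_mem_iSup _ hx
  refine ⟨s.image Subtype.val, by simp, ?_⟩
  refine (iSup₂_le fun i hi => ?_ : (⨆ i ∈ s, A (i : U)) ≤ _) hs
  exact le_sumOn (by simpa using hi)

variable [LinearOrder U]

variable (A) in
/-- The closed subsets in the sense of the Hill lemma. -/
def IsHillClosed (T : Set U) : Prop :=
  ∀ i ∈ T, A i ⊓ sumOn A (Set.Iio i) ≤ sumOn A (T ∩ Set.Iio i)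

lemma IsHillClosed.iUnion {ι : Sort*} {T : ι → Set U} (hT : ∀ k, IsHillClosed A (T k)) :
    IsHillClosed A (⋃ k, T k) := by
  intro i hi
  obtain ⟨k, hk⟩ := Set.mem_iUnion.mp hi
  exact (hT k i hk).trans (sumOn_mono (Set.inter_subset_inter_left _ (Set.subset_iUnion T k)))

lemma IsHillClosed.union {T T' : Set U} (hT : IsHillClosed A T) (hT' : IsHillClosed A T') :
    IsHillClosed A (T ∪ T') := by
  rw [Set.union_eq_iUnion]
  exact .iUnion (by rintro (_ | _) <;> assumption)

lemma isHillClosed_Iio (i : U) : IsHillClosed A (Set.Iio i) := fun _ hj =>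
  inf_le_right.trans (sumOn_mono fun _ hk =>
    ⟨Set.mem_Iio.mpr (lt_trans (Set.mem_Iio.mp hk) (Set.mem_Iio.mp hj)), hk⟩)

lemma exists_mem_sumOn_Iic {T : Set U} {x : M} (hx : x ∈ sumOn A T) (h0 : x ≠ 0) :
    ∃ j ∈ T, x ∈ sumOn A (T ∩ Set.Iic j) := by
  obtain ⟨t, htT, hxt⟩ := exists_finset_of_mem_sumOn hx
  rcases t.eq_empty_or_nonempty with rfl | hne
  · simp [sumOn, h0] at hxt
  · exact ⟨t.max' hne, htT (t.max'_mem hne),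
      mem_sumOn_of_subset hxt fun i hi => ⟨htT hi, Set.mem_Iic.mpr (t.le_max' i hi)⟩⟩

variable [WellFoundedLT U]

/-- Induction on an upper bound `j` for the indices used. If `j ∉ C`, then all of `C` lies below
`j`, so the `A j`-component lies in the sum over lower indices. Closedness rewrites that component
with indices of `T` below `j`. -/
lemma IsHillClosed.sumOn_inf_sumOn_le {T C : Set U} (hT : IsHillClosed A T) (hC : IsLowerSet C) :
    sumOn A T ⊓ sumOn A C ≤ sumOn A (T ∩ C) := by
  have key : ∀ j, ∀ x ∈ sumOn A (T ∩ Set.Iic j), x ∈ sumOn A C → x ∈ sumOn A (T ∩ C) := by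
    intro j
    induction j using WellFoundedLT.induction with
    | ind j ih =>
    intro x hx hxC
    by_cases hjC : j ∈ C
    · exact mem_sumOn_of_subset hx fun i hi => ⟨hi.1, hC hi.2 hjC⟩
    have hCj : C ⊆ Set.Iio j := fun i hi => lt_of_not_ge fun h => hjC (hC h hi)
    have hx' : x ∈ sumOn A (T ∩ Set.Iio j) := by
      by_cases hjT : j ∈ T
      · have : T ∩ Set.Iic j = (T ∩ Set.Iio j) ∪ {j} := by
          ext i
          simp only [Set.mem_inter_iff, Set.mem_Iic, Set.mem_Iio, Set.union_singleton,
            Set.mem_insert_iff, le_iff_lt_or_eq]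
          constructor
          · rintro ⟨h1, h2 | h2⟩
            · exact .inr ⟨h1, h2⟩
            · exact .inl h2
          · rintro (rfl | h)
            · exact ⟨hjT, .inr rfl⟩
            · exact ⟨h.1, .inl h.2⟩
        rw [this, sumOn_union, sumOn_singleton] at hx
        obtain ⟨y, hy, a, ha, rfl⟩ := Submodule.mem_sup.mp hx
        refine add_mem hy (hT j hjT ⟨ha, ?_⟩)
        have h1 := sub_mem (sumOn_mono hCj hxC) (sumOn_mono Set.inter_subset_right hy)
        simpa using h1
      · exact mem_sumOn_of_subset hx fun i hi => ⟨hi.1, Set.mem_Iio.mpr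
          (lt_of_le_of_ne (Set.mem_Iic.mp hi.2) fun h => hjT (h ▸ hi.1))⟩
    by_cases h0 : x = 0
    · rw [h0]; exact zero_mem _
    obtain ⟨k, hk, hxk⟩ := exists_mem_sumOn_Iic hx' h0
    exact ih k (Set.mem_Iio.mp hk.2) x
      (mem_sumOn_of_subset hxk fun i hi => ⟨hi.1.1, hi.2⟩) hxC
  rintro x ⟨hx, hxC⟩
  by_cases h0 : x = 0
  · rw [h0]; exact zero_mem _
  obtain ⟨k, -, hxk⟩ := exists_mem_sumOn_Iic hx h0
  exact key k x hxk hxC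

/-- Passing to the quotient by `sumOn A T` therefore leaves the `i`-th factor unchanged when `i ∉
T`. The proof cuts the closed set `Set.Iio i ∪ T` with the lower set `Set.Iic i`. -/
lemma IsHillClosed.inf_sup_le {T : Set U} (hT : IsHillClosed A T) {i : U} (hi : i ∉ T) :
    A i ⊓ (sumOn A (Set.Iio i) ⊔ sumOn A T) ≤ sumOn A (Set.Iio i) := by
  rw [← sumOn_union]
  rintro x ⟨hx, hx'⟩
  have := ((isHillClosed_Iio i).union hT).sumOn_inf_sumOn_le (isLowerSet_Iic i)
    ⟨hx', le_sumOn (A := A) (Set.mem_Iic.mpr le_rfl) hx⟩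
  refine sumOn_mono ?_ this
  rintro j ⟨hj | hj, hji⟩
  · exact hj
  · refine lt_of_le_of_ne hji ?_
    rintro rfl
    exact hi hj

variable {κ : Cardinal.{u}}

/-- Each element of a closed subset lies in a closed subset of it of size at most `κ`. -/
lemma IsHillClosed.exists_small (hκ : ℵ₀ ≤ κ)
    (hA : ∀ i, IsGeneratedLE κ (A i ⊓ sumOn A (Set.Iio i)))
    {T : Set U} (hT : IsHillClosed A T) (i : U) (hi : i ∈ T) :
    ∃ T' ⊆ T, IsHillClosed A T' ∧ i ∈ T' ∧ #T' ≤ κ := by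
  induction i using WellFoundedLT.induction with
  | ind i ih =>
  obtain ⟨s, hs, hsA⟩ := hA i
  -- Each of the at most `κ` generators needs finitely many indices of `T` below `i`. The small
  -- closed sets that induction gives for these indices, together with `i`, form the required set.
  have h1 (z : s) : ∃ t : Finset U, (t : Set U) ⊆ T ∩ Set.Iio i ∧ (z : M) ∈ sumOn A (t : Set U) :=
    exists_finset_of_mem_sumOn (hT i hi (hsA ▸ Submodule.subset_span z.2))
  choose t htT hzt using h1
  choose T' hT'T hT'c hT'm hT'κ using ih
  have hV (z : s) (j : U) (hj : j ∈ t z) : j < i ∧ j ∈ T := ⟨(htT z hj).2, (htT z hj).1⟩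
  let V : (Σ z : s, t z) → Set U := fun p => T' p.2 (hV p.1 _ p.2.2).1 (hV p.1 _ p.2.2).2
  have hcard : #(Σ z : s, t z) ≤ κ := by
    rw [Cardinal.mk_sigma]
    refine (Cardinal.sum_le_mk_mul_iSup _).trans ((mul_le_mul' hs (ciSup_le' fun z => ?_)).trans
      (Cardinal.mul_eq_self hκ).le)
    exact (Cardinal.mk_lt_aleph0_iff.mpr inferInstance).le.trans hκ
  refine ⟨insert i (⋃ p, V p), ?_, ?_, Set.mem_insert _ _, ?_⟩
  · exact Set.insert_subset hi (Set.iUnion_subset fun p => hT'T _ _ _)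
  · rintro j (rfl | hj)
    · rw [← hsA, Submodule.span_le]
      intro z hz
      refine sumOn_mono ?_ (hzt ⟨z, hz⟩)
      intro k hk
      exact ⟨.inr (Set.mem_iUnion.mpr ⟨⟨⟨z, hz⟩, ⟨k, hk⟩⟩, hT'm _ _ _⟩), (hV _ _ hk).1⟩
    · refine (IsHillClosed.iUnion (T := V) (fun p => hT'c _ _ _) j hj).trans (sumOn_mono ?_)
      exact Set.inter_subset_inter_left _ (Set.subset_insert _ _)
  · refine (Cardinal.mk_insert_le).trans ?_
    refine (add_le_add ((Cardinal.mk_iUnion_le V).trans ((mul_le_mul' hcard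
      (ciSup_le' fun p => hT'κ _ _ _)).trans (Cardinal.mul_eq_self hκ).le))
      (Cardinal.one_le_aleph0.trans hκ)).trans (Cardinal.add_eq_self hκ).le

lemma exists_isHillClosed_of_subset (hκ : ℵ₀ ≤ κ)
    (hA : ∀ i, IsGeneratedLE κ (A i ⊓ sumOn A (Set.Iio i))) (htop : sumOn A Set.univ = ⊤)
    (s : Set M) (hs : #s ≤ κ) : ∃ T, IsHillClosed A T ∧ #T ≤ κ ∧ s ⊆ sumOn A T := by
  have hU : IsHillClosed A (Set.univ : Set U) := fun i _ =>
    inf_le_right.trans (sumOn_mono (by simp))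
  have h1 (z : s) : ∃ t : Finset U, (t : Set U) ⊆ Set.univ ∧ (z : M) ∈ sumOn A (t : Set U) :=
    exists_finset_of_mem_sumOn (htop ▸ Submodule.mem_top)
  choose t _ hzt using h1
  choose T _ hTc hTm hTκ using fun i => hU.exists_small hκ hA i (Set.mem_univ i)
  have hcard : #(Σ z : s, t z) ≤ κ := by
    rw [Cardinal.mk_sigma]
    refine (Cardinal.sum_le_mk_mul_iSup _).trans ((mul_le_mul' hs (ciSup_le' fun z => ?_)).trans
      (Cardinal.mul_eq_self hκ).le)
    exact (Cardinal.mk_lt_aleph0_iff.mpr inferInstance).le.trans hκ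
  refine ⟨⋃ p : Σ z : s, t z, T p.2, .iUnion fun p => hTc _, ?_, ?_⟩
  · exact (Cardinal.mk_iUnion_le _).trans ((mul_le_mul' hcard
      (ciSup_le' fun p => hTκ _)).trans (Cardinal.mul_eq_self hκ).le)
  · intro z hz
    refine sumOn_mono ?_ (hzt ⟨z, hz⟩)
    intro k hk
    exact Set.mem_iUnion.mpr ⟨⟨⟨z, hz⟩, ⟨k, hk⟩⟩, hTm _⟩

/-- The images of the partial sums filter the quotient. The factor at `i` vanishes for `i ∈ T` and
is the original one otherwise, by `IsHillClosed.inf_sup_le`. -/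
lemma IsHillClosed.isFlatMittagLeffler_quotient {T : Set U} (hT : IsHillClosed A T)
    (htop : sumOn A Set.univ = ⊤)
    (h : ∀ i, IsFlatMittagLeffler R (A i ⧸ (sumOn A (Set.Iio i)).submoduleOf (A i))) :
    IsFlatMittagLeffler R (M ⧸ sumOn A T) := by
  let q := (sumOn A T).mkQ
  let ρ : U → Ordinal.{u} := Ordinal.typein (· < ·)
  let σ : Ordinal.{u} := Ordinal.type ((· < ·) : U → U → Prop)
  have hρ (i j) : ρ i < ρ j ↔ i < j := Ordinal.typein_lt_typein _
  let G : Ordinal.{u} → Submodule R (M ⧸ sumOn A T) := fun α => (sumOn A {i | ρ i < α}).map q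
  have hGm : Monotone G := fun α β hαβ => Submodule.map_mono (sumOn_mono fun i hi =>
    Set.mem_ofPred_eq.mpr ((Set.mem_ofPred_eq.mp hi).trans_le hαβ))
  have hG : IsContinuousChain σ G :=
    { mono := fun α β hαβ _ => hGm hαβ
      zero := by
        have : {i | ρ i < 0} = ∅ := by ext i; simp
        simp only [G, this, sumOn, Set.mem_empty_iff_false, iSup_false, iSup_bot]
        exact Submodule.map_bot q
      limit := by
        intro α _ hα
        have : G α = ⨆ β : Set.Iio α, G β := by
          simp only [G]
          rw [← Submodule.map_iSup, ← sumOn_iUnion]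
          congr 2
          ext i
          simp only [Set.mem_ofPred_eq, Set.mem_iUnion, Subtype.exists, Set.mem_Iio, exists_prop]
          exact ⟨fun hi => ⟨_, hα.succ_lt hi, Order.lt_succ _⟩,
            fun ⟨β, hβ, hi⟩ => hi.trans hβ⟩
        rw [this]
        have : Nonempty (Set.Iio α) := ⟨⟨0, by simpa using hα.bot_lt⟩⟩
        refine Submodule.coe_iSup_of_directed _ (Monotone.directed_le ?_)
        exact fun β γ hβγ => hGm hβγ }
  refine hG.isFlatMittagLeffler ?_ ?_
  · have : {i | ρ i < σ} = Set.univ := by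
      ext i
      simpa using Ordinal.typein_lt_type ((· < ·) : U → U → Prop) i
    simp only [G, this, htop, Submodule.map_top, q, Submodule.range_mkQ]
  · intro α hα
    obtain ⟨i, rfl⟩ : ∃ i, ρ i = α := ⟨_, Ordinal.typein_enum _ hα⟩
    have h1 : {j | ρ j < ρ i} = Set.Iio i := by
      ext j
      exact hρ j i
    have h2 : {j | ρ j < Order.succ (ρ i)} = Set.Iio i ∪ {i} := by
      ext j
      rw [Set.mem_ofPred_eq, Order.lt_succ_iff, ← not_lt, hρ, not_lt, le_iff_lt_or_eq]
      rfl
    have hsucc : G (Order.succ (ρ i)) = (A i).map q ⊔ G (ρ i) := by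
      simp only [G, h1, h2, sumOn_union, sumOn_singleton, Submodule.map_sup, sup_comm]
    by_cases hi : i ∈ T
    · have : (A i).map q = ⊥ := by
        rw [eq_bot_iff, Submodule.map_le_iff_le_comap]
        intro x hx
        exact (Submodule.Quotient.mk_eq_zero _).mpr (le_sumOn hi hx)
      rw [this, bot_sup_eq] at hsucc
      have : Subsingleton (G (Order.succ (ρ i)) ⧸
          (G (ρ i)).submoduleOf (G (Order.succ (ρ i)))) := by
        rw [Submodule.Quotient.subsingleton_iff, Submodule.submoduleOf_eq_top, hsucc]
      exact .of_subsingleton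
    · have hq : ∀ a ∈ A i, q a ∈ G (ρ i) ↔ a ∈ sumOn A (Set.Iio i) := by
        intro a ha
        have : q a ∈ G (ρ i) ↔ a ∈ sumOn A (Set.Iio i) ⊔ sumOn A T := by
          simp only [G, h1]
          rw [← Submodule.mem_comap, Submodule.comap_map_eq, Submodule.ker_mkQ]
        rw [this]
        exact ⟨fun h => hT.inf_sup_le hi ⟨ha, h⟩, fun h => Submodule.mem_sup_left h⟩
      obtain ⟨e⟩ := nonempty_quotient_submoduleOf_equiv q (A i) (sumOn A (Set.Iio i))
        (G (Order.succ (ρ i))) (G (ρ i)) (hsucc ▸ le_sup_left) hsucc.le hq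
      exact (h i).congr e.symm

/-- The module is filtered by the images of the `A i` with `i ∈ T' \ T`. Closedness of both sets
identifies the factors with the original ones, and `isPresentedLE_iSup` applies. -/
lemma IsHillClosed.isPresentedLE_map_mkQ (hκ : ℵ₀ ≤ κ) (hA : ∀ i, IsGeneratedLE κ (A i))
    (hp : ∀ i, IsPresentedLE R (A i ⧸ (sumOn A (Set.Iio i)).submoduleOf (A i)) κ)
    {T T' : Set U} (hT : IsHillClosed A T) (hT' : IsHillClosed A T') (hcard : #T' ≤ κ) :
    IsPresentedLE R ((sumOn A T').map (sumOn A T).mkQ) κ := by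
  let q := (sumOn A T).mkQ
  let V : Set U := T' \ T
  have hV : ∀ i ∈ T, (A i).map q = ⊥ := by
    intro i hi
    rw [eq_bot_iff, Submodule.map_le_iff_le_comap]
    intro x hx
    exact (Submodule.Quotient.mk_eq_zero _).mpr (le_sumOn hi hx)
  have hmap : ∀ W : Set U, (sumOn A W).map q = (sumOn A (W \ T)).map q := by
    intro W
    refine le_antisymm ?_ (Submodule.map_mono (sumOn_mono Set.sdiff_subset))
    rw [Submodule.map_le_iff_le_comap]
    refine sumOn_le fun i hi => Submodule.map_le_iff_le_comap.mp ?_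
    by_cases hiT : i ∈ T
    · rw [hV i hiT]; exact bot_le
    · exact Submodule.map_mono (le_sumOn ⟨hi, hiT⟩)
  have hsum : ∀ W : Set U, (sumOn A W).map q = ⨆ i : W, (A i).map q := by
    intro W
    exact (congrArg _ (iSup_subtype' (f := fun i _ => A i))).trans (Submodule.map_iSup _ _)
  have key := isPresentedLE_iSup hκ ((Cardinal.mk_le_mk_of_subset Set.sdiff_subset).trans hcard)
    (fun i : V => (A i).map q) (fun i => (hA i).map q) ?_
  · exact key.congr (LinearEquiv.ofEq _ _ ((hsum V).symm.trans (hmap T').symm))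
  · intro i
    have hlow : (⨆ j : Set.Iio i, (A j).map q) = (sumOn A (T' ∩ Set.Iio (i : U))).map q := by
      rw [hmap, hsum]
      refine le_antisymm (iSup_le fun j => ?_) (iSup_le fun j => ?_)
      · exact le_iSup (fun j : ↑((T' ∩ Set.Iio (i : U)) \ T) => (A j).map q)
          ⟨j, ⟨⟨j.1.2.1, j.2⟩, j.1.2.2⟩⟩
      · exact le_iSup (fun j : Set.Iio i => (A j).map q) ⟨⟨j, j.2.1.1, j.2.2⟩, j.2.1.2⟩
    rw [hlow]
    have hq : ∀ a ∈ A i, q a ∈ (sumOn A (T' ∩ Set.Iio (i : U))).map q ↔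
        a ∈ sumOn A (Set.Iio (i : U)) := by
      intro a ha
      rw [← Submodule.mem_comap, Submodule.comap_map_eq, Submodule.ker_mkQ]
      refine ⟨fun h => hT.inf_sup_le i.2.2 ⟨ha, ?_⟩, fun h =>
        Submodule.mem_sup_left (hT' i i.2.1 ⟨ha, h⟩)⟩
      have hle : sumOn A (T' ∩ Set.Iio (i : U)) ≤ sumOn A (Set.Iio (i : U)) :=
        sumOn_mono Set.inter_subset_right
      have hle' := sup_le_sup_right hle (sumOn A T)
      exact hle' h
    obtain ⟨e⟩ := nonempty_quotient_submoduleOf_equiv q (A i) (sumOn A (Set.Iio (i : U)))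
      ((A i).map q) ((sumOn A (T' ∩ Set.Iio (i : U))).map q) le_rfl le_sup_left hq
    exact (hp i).congr e

end Hill

/-! ### The Hill lemma -/

section HillFamily

variable {R : Type u} [CommRing R] {M : Type u} [AddCommGroup M] [Module R M]

/-- A family `H` of submodules of `M`, with a subfamily `H₀` of `κ`-generated ones, as provided by
the Hill lemma for a `κ`-restricted flat Mittag-Leffler module. -/
structure IsHillFamily (κ : Cardinal.{u}) (H H₀ : Set (Submodule R M)) : Prop where
  sSup_mem : ∀ 𝒜 ⊆ H, sSup 𝒜 ∈ H
  subset : H₀ ⊆ H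
  iSup_nat_mem : ∀ f : ℕ → Submodule R M, (∀ n, f n ∈ H₀) → ⨆ n, f n ∈ H₀
  exists_le : ∀ B : Submodule R M, IsGeneratedLE κ B → ∃ C ∈ H₀, B ≤ C
  isGeneratedLE : ∀ C ∈ H₀, IsGeneratedLE κ C
  quotient : ∀ A ∈ H, IsFlatMittagLeffler R (M ⧸ A)
  isPresentedLE : ∀ A ∈ H, ∀ C ∈ H₀, IsPresentedLE R (C.map A.mkQ) κ

lemma exists_isHillFamily_of_sumOn {κ : Cardinal.{u}} (hκ : ℵ₀ ≤ κ) {U : Type u} [LinearOrder U]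
    [WellFoundedLT U] {A : U → Submodule R M} (htop : sumOn A Set.univ = ⊤)
    (hA : ∀ i, IsGeneratedLE κ (A i))
    (h : ∀ i, IsPresentedFlatMittagLeffler R
      (A i ⧸ (sumOn A (Set.Iio i)).submoduleOf (A i)) κ) :
    ∃ H H₀ : Set (Submodule R M), IsHillFamily κ H H₀ := by
  have hAB (i) : IsGeneratedLE κ (A i ⊓ sumOn A (Set.Iio i)) := by
    have := ((h i).1.isGeneratedLE_ker hκ (hA i).top _ (Submodule.mkQ_surjective _)).map
      (A i).subtype
    rwa [Submodule.ker_mkQ, Submodule.submoduleOf, Submodule.map_comap_subtype] at this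
  refine ⟨sumOn A '' {T | IsHillClosed A T}, sumOn A '' {T | IsHillClosed A T ∧ #T ≤ κ}, ?_⟩
  constructor
  · intro 𝒜 h𝒜
    choose T hT hTA using h𝒜
    refine ⟨⋃ B : 𝒜, T B.2, .iUnion fun B => hT B.2, ?_⟩
    rw [sumOn_iUnion, sSup_eq_iSup']
    exact iSup_congr fun B => (hTA B.2 : _)
  · exact Set.image_mono fun T hT => hT.1
  · intro f hf
    choose T hT hTf using hf
    refine ⟨⋃ n, T n, ⟨.iUnion fun n => (hT n).1, ?_⟩, ?_⟩
    · rw [← Equiv.ulift.{u}.surjective.iUnion_comp]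
      refine (Cardinal.mk_iUnion_le _).trans ((mul_le_mul' (?_ : _ ≤ κ)
        (ciSup_le' fun p => (hT _).2)).trans (Cardinal.mul_eq_self hκ).le)
      simpa using hκ
    · rw [sumOn_iUnion]
      exact iSup_congr hTf
  · rintro B ⟨s, hs, rfl⟩
    obtain ⟨T, hT, hTκ, hsT⟩ := exists_isHillClosed_of_subset hκ hAB htop s hs
    exact ⟨_, ⟨T, ⟨hT, hTκ⟩, rfl⟩, Submodule.span_le.mpr hsT⟩
  · rintro _ ⟨T, ⟨hT, hTκ⟩, rfl⟩
    rw [sumOn, iSup_subtype']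
    exact isGeneratedLE_iSup hκ hTκ fun i => hA i
  · rintro _ ⟨T, hT, rfl⟩
    exact hT.isFlatMittagLeffler_quotient htop fun i => (h i).2
  · rintro _ ⟨T, hT, rfl⟩ _ ⟨T', ⟨hT', hTκ⟩, rfl⟩
    exact hT.isPresentedLE_map_mkQ hκ hA (fun i => (h i).1) hT' hTκ

lemma IsPresentedFlatMittagLeffler.congr {κ : Cardinal.{u}} {N : Type u} [AddCommGroup N]
    [Module R N] (h : IsPresentedFlatMittagLeffler R M κ) (e : M ≃ₗ[R] N) :
    IsPresentedFlatMittagLeffler R N κ :=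
  ⟨h.1.congr e, IsFlatMittagLeffler.congr h.2 e.symm⟩

/-- The Hill lemma. -/
lemma IsRestrictedFlatMittagLeffler.exists_isHillFamily {κ : Cardinal.{u}} (hκ : ℵ₀ ≤ κ)
    (h : IsRestrictedFlatMittagLeffler R M κ) :
    ∃ H H₀ : Set (Submodule R M), IsHillFamily κ H H₀ := by
  obtain ⟨σ, F, hmono, hzero, hlim, htop, hfac⟩ := h
  have hF : IsContinuousChain σ F := ⟨hmono, hzero, hlim⟩
  have hfac' (α : Ordinal.{u}) (hα : α < σ) : IsPresentedFlatMittagLeffler R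
      (F (Order.succ α) ⧸ (F α).submoduleOf (F (Order.succ α))) κ := by
    obtain ⟨N, _, _, hN, ⟨e⟩⟩ := hfac α hα
    exact hN.congr e.symm
  have hle (α : Ordinal.{u}) (hα : α < σ) : F α ≤ F (Order.succ α) :=
    hmono _ _ (Order.le_succ α) (Order.succ_le_of_lt hα)
  -- Each step of the chain is generated by `κ`-many new elements, so the chain becomes the partial
  -- sums of a well-ordered family of `κ`-generated submodules.
  choose! C hC hCF using fun α (hα : α < σ) =>
    exists_isGeneratedLE_sup_eq (hle α hα) (hfac' α hα).1.isGeneratedLE_top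
  let ρ : σ.ToType → Ordinal.{u} := fun i => (Ordinal.ToType.toOrd i : Ordinal.{u})
  have hρσ (i) : ρ i < σ := (Ordinal.ToType.toOrd i).2
  have hρ (i j) : ρ i < ρ j ↔ i < j := Ordinal.ToType.mk.symm.lt_iff_lt
  have hρsurj (α) (hα : α < σ) : ∃ i, ρ i = α := by
    obtain ⟨i, hi⟩ := Ordinal.ToType.mk.symm.surjective (⟨α, hα⟩ : Set.Iio σ)
    exact ⟨i, congrArg Subtype.val hi⟩
  let A : σ.ToType → Submodule R M := fun i => C (ρ i)
  have hsum : ∀ α ≤ σ, F α = sumOn A {i | ρ i < α} := by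
    intro α
    induction α using SuccOrder.limitRecOn with
    | isMin α hα =>
      intro _
      rw [hα.eq_bot, Ordinal.bot_eq_zero, hzero]
      simp [sumOn]
    | succ α _ ih =>
      intro hα
      have hα' := (Order.lt_succ α).trans_le hα
      obtain ⟨i, rfl⟩ := hρsurj α hα'
      have : {j | ρ j < Order.succ (ρ i)} = {j | ρ j < ρ i} ∪ {i} := by
        ext j
        rw [Set.mem_ofPred_eq, Order.lt_succ_iff, ← not_lt, hρ, not_lt, le_iff_lt_or_eq, ← hρ]
        rfl
      rw [this, sumOn_union, sumOn_singleton, ← ih hα'.le, hCF _ hα']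
    | isSuccLimit α hl ih =>
      intro hα
      refine le_antisymm ?_ (sumOn_le fun i hi => ?_)
      · intro x hx
        rw [← SetLike.mem_coe, hlim α hα hl] at hx
        obtain ⟨⟨β, hβ⟩, hxβ⟩ := Set.mem_iUnion.mp hx
        rw [SetLike.mem_coe, ih β hβ (le_of_lt (lt_of_lt_of_le hβ hα))] at hxβ
        exact mem_sumOn_of_subset hxβ fun i hi => Set.mem_ofPred_eq.mpr
          ((Set.mem_ofPred_eq.mp hi).trans (Set.mem_Iio.mp hβ))
      · have hi' : ρ i < α := Set.mem_ofPred_eq.mp hi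
        exact (le_sup_right.trans (hCF _ (hρσ i)).le).trans
          (hmono _ _ (Order.succ_le_of_lt hi') hα)
  have hIio (i) : sumOn A (Set.Iio i) = F (ρ i) := by
    rw [hsum _ (hρσ i).le]
    congr 1
    ext j
    exact (hρ j i).symm
  refine exists_isHillFamily_of_sumOn (A := A) hκ ?_ (fun i => hC _ (hρσ i)) fun i => ?_
  · rw [← htop, hsum σ le_rfl]
    congr 1
    ext i
    simpa using hρσ i
  · rw [hIio]
    obtain ⟨e⟩ := nonempty_quotient_submoduleOf_equiv LinearMap.id (A i) (F (ρ i))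
      (F (Order.succ (ρ i))) (F (ρ i))
      (by rw [Submodule.map_id]; exact le_sup_right.trans (hCF _ (hρσ i)).le)
      (by rw [Submodule.map_id, sup_comm]; exact (hCF _ (hρσ i)).ge) (by simp)
    exact (hfac' _ (hρσ i)).congr e.symm

end HillFamily

/-! ### Base change and ascent -/

section BaseChange

variable {R : Type u} [CommRing R] {M : Type u} [AddCommGroup M] [Module R M]
  (S : Type u) [CommRing S] [Algebra R S]

lemma baseChange_iSup {ι : Sort*} (A : ι → Submodule R M) :
    (⨆ i, A i).baseChange S = ⨆ i, (A i).baseChange S := by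
  refine le_antisymm ?_ (iSup_le fun i => Submodule.baseChange_mono _ (le_iSup A i))
  rw [Submodule.baseChange_eq_span, Submodule.span_le, Submodule.map_iSup]
  refine (iSup_le fun i => ?_ :
    _ ≤ (⨆ i, (A i).baseChange S : Submodule S (S ⊗[R] M)).restrictScalars R)
  rintro _ ⟨x, hx, rfl⟩
  exact Submodule.mem_iSup_of_mem i (Submodule.tmul_mem_baseChange_of_mem 1 hx)

lemma baseChange_map {N : Type u} [AddCommGroup N] [Module R N] (f : M →ₗ[R] N)
    (A : Submodule R M) : (A.map f).baseChange S = (A.baseChange S).map (f.baseChange S) := by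
  simp only [Submodule.baseChange_eq_span, Submodule.map_span]
  congr 1
  ext x
  simp

lemma exists_quotient_baseChange_equiv (A : Submodule R M) :
    ∃ e : ((S ⊗[R] M) ⧸ A.baseChange S) ≃ₗ[S] S ⊗[R] (M ⧸ A),
      e.toLinearMap ∘ₗ (A.baseChange S).mkQ = A.mkQ.baseChange S := by
  have hk : LinearMap.ker (A.mkQ.baseChange S) = A.baseChange S := by
    rw [ker_baseChange _ A.mkQ_surjective, Submodule.ker_mkQ]
  refine ⟨(Submodule.quotEquivOfEq _ _ hk.symm).trans ((A.mkQ.baseChange S).quotKerEquivOfSurjective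
    (LinearMap.lTensor_surjective S A.mkQ_surjective)), ?_⟩
  ext x
  rfl

/-- Flat base change commutes with forming the quotient `(A + C) / A`. -/
lemma nonempty_tensor_map_mkQ_equiv [Module.Flat R S] (A C : Submodule R M) :
    Nonempty ((S ⊗[R] (C.map A.mkQ)) ≃ₗ[S] (C.baseChange S).map (A.baseChange S).mkQ) := by
  obtain ⟨e, he⟩ := exists_quotient_baseChange_equiv S A
  refine ⟨(Submodule.toBaseChange.toLinearEquiv S (C.map A.mkQ)).trans
    ((LinearEquiv.ofEq _ _ ?_).trans (e.submoduleMap _).symm)⟩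
  rw [baseChange_map, ← he, Submodule.map_comp]

/-- Every element of the base change involves only finitely many elements of `A`. This is how small
submodules upstairs are bounded by small ones downstairs. -/
lemma exists_isGeneratedLE_le_baseChange {κ : Cardinal.{u}} (hκ : ℵ₀ ≤ κ) (A : Submodule R M)
    (B : Submodule S (S ⊗[R] M)) (hB : IsGeneratedLE κ B) (hBA : B ≤ A.baseChange S) :
    ∃ D ≤ A, IsGeneratedLE κ D ∧ B ≤ D.baseChange S := by
  have h1 (z : S ⊗[R] M) (hz : z ∈ A.baseChange S) :
      ∃ D ≤ A, IsGeneratedLE κ D ∧ z ∈ D.baseChange S := by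
    rw [Submodule.baseChange_eq_span] at hz
    induction hz using Submodule.span_induction with
    | mem z hz =>
      obtain ⟨x, hx, rfl⟩ := hz
      refine ⟨Submodule.span R {x}, by simpa using hx,
        isGeneratedLE_of_finite hκ (Set.finite_singleton x),
        Submodule.tmul_mem_baseChange_of_mem 1 (Submodule.mem_span_singleton_self x)⟩
    | zero => exact ⟨⊥, bot_le, ⟨∅, by simp, by simp⟩, zero_mem _⟩
    | add y z _ _ hy hz =>
      obtain ⟨D, hD, hD', hyD⟩ := hy
      obtain ⟨E, hE, hE', hzE⟩ := hz
      exact ⟨D ⊔ E, sup_le hD hE, hD'.sup hκ hE', add_mem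
        (Submodule.baseChange_mono _ le_sup_left hyD) (Submodule.baseChange_mono _ le_sup_right hzE)⟩
    | smul a z _ hz =>
      obtain ⟨D, hD, hD', hzD⟩ := hz
      exact ⟨D, hD, hD', Submodule.smul_mem _ _ hzD⟩
  obtain ⟨s, hs, rfl⟩ := hB
  choose D hDA hDg hD using fun z : s => h1 z (hBA (Submodule.subset_span z.2))
  refine ⟨⨆ z, D z, iSup_le hDA, isGeneratedLE_iSup hκ hs hDg, Submodule.span_le.mpr fun z hz => ?_⟩
  exact Submodule.baseChange_mono _ (le_iSup D ⟨z, hz⟩) (hD ⟨z, hz⟩)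

variable {S}

/-- Reflection of zero for `S`-linear families can be tested before base change to `S`. -/
lemma tensorReflects_baseChange_iff {ι P : Type u} [AddCommGroup P] [Module R P] [Module S P]
    [IsScalarTower R S P] {Q : ι → Type u} [∀ i, AddCommGroup (Q i)] [∀ i, Module R (Q i)]
    [∀ i, Module S (Q i)] [∀ i, IsScalarTower R S (Q i)] (g : ∀ i, P →ₗ[S] Q i) :
    TensorReflects (R := S) (S ⊗[R] M) g ↔
      TensorReflects M (fun i => (g i).restrictScalars R) := by
  let θ (P : Type u) [AddCommGroup P] [Module R P] [Module S P] [IsScalarTower R S P] :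
      (S ⊗[R] M) ⊗[S] P ≃+ M ⊗[R] P :=
    ((TensorProduct.comm S _ _).trans
      (TensorProduct.AlgebraTensorModule.cancelBaseChange R S S P M)).toAddEquiv.trans
      (TensorProduct.comm R _ _).toAddEquiv
  have hθ (i) (x : (S ⊗[R] M) ⊗[S] P) : θ (Q i) ((g i).lTensor (S ⊗[R] M) x) =
      ((g i).restrictScalars R).lTensor M (θ P x) := by
    induction x with
    | zero => simp
    | add x y hx hy => simp [hx, hy]
    | tmul y p =>
      induction y with
      | zero => simp
      | add x y hx hy => simp only [TensorProduct.add_tmul, map_add, hx, hy]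
      | tmul s m => simp [θ]
  constructor
  · intro h x hx
    have := h ((θ P).symm x) fun i => (θ (Q i)).injective (by
      rw [hθ, AddEquiv.apply_symm_apply, hx, map_zero])
    simpa using this
  · intro h x hx
    have := h (θ P x) fun i => by rw [← hθ, hx, map_zero]
    simpa using this

lemma IsMittagLeffler.baseChange (h : IsMittagLeffler R M) : IsMittagLeffler S (S ⊗[R] M) := by
  rw [isMittagLeffler_iff_tensorReflects] at h ⊢
  intro ι Q _ _
  -- A family of `S`-modules is tested as a family of `R`-modules, since `(S ⊗[R] M) ⊗[S] Q` is `M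
  -- ⊗[R] Q`.
  let (i : ι) : Module R (Q i) := Module.compHom (Q i) (algebraMap R S)
  have (i : ι) : IsScalarTower R S (Q i) := .of_algebraMap_smul fun _ _ => rfl
  exact (tensorReflects_baseChange_iff _).mpr (h ι Q)

lemma IsFlatMittagLeffler.baseChange (h : IsFlatMittagLeffler R M) :
    IsFlatMittagLeffler S (S ⊗[R] M) :=
  have := h.1
  ⟨inferInstance, h.2.baseChange⟩

/-- `κ`-restricted flat Mittag-Leffler modules ascend along flat ring homomorphisms. -/
lemma IsRestrictedFlatMittagLeffler.baseChange {κ : Cardinal.{u}} [Module.Flat R S]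
    (h : IsRestrictedFlatMittagLeffler R M κ) :
    IsRestrictedFlatMittagLeffler S (S ⊗[R] M) κ := by
  obtain ⟨σ, F, hmono, hzero, hlim, htop, hfac⟩ := h
  refine ⟨σ, fun α => (F α).baseChange S,
    fun α β hαβ hβ => Submodule.baseChange_mono _ (hmono α β hαβ hβ), by simp [hzero], ?_,
    by simp [htop], ?_⟩
  · intro α hα hl
    have : F α = ⨆ β : Set.Iio α, F β := by
      refine le_antisymm (fun x hx => ?_) (iSup_le fun β => hmono _ _ β.2.le hα)
      rw [← SetLike.mem_coe, hlim α hα hl] at hx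
      obtain ⟨β, hβ⟩ := Set.mem_iUnion.mp hx
      exact Submodule.mem_iSup_of_mem β hβ
    simp only [this, baseChange_iSup]
    have : Nonempty (Set.Iio α) := ⟨⟨0, by simpa using hl.bot_lt⟩⟩
    refine Submodule.coe_iSup_of_directed _ (Monotone.directed_le ?_)
    exact fun β γ hβγ => Submodule.baseChange_mono _ (hmono _ _ hβγ (γ.2.le.trans hα))
  · intro α hα
    obtain ⟨N, _, _, hN, ⟨e⟩⟩ := hfac α hα
    refine ⟨S ⊗[R] N, inferInstance, inferInstance,
      ⟨hN.1.baseChange S, IsFlatMittagLeffler.baseChange hN.2⟩, ?_⟩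
    obtain ⟨e₁⟩ := nonempty_map_mkQ_equiv (A := (F α).baseChange S)
      (B := (F (Order.succ α)).baseChange S)
    obtain ⟨e₂⟩ := nonempty_tensor_map_mkQ_equiv S (F α) (F (Order.succ α))
    obtain ⟨e₃⟩ := nonempty_map_mkQ_equiv (A := F α) (B := F (Order.succ α))
    exact ⟨e₁.trans (e₂.symm.trans ((e₃.symm.trans e).baseChange R S _ _))⟩

end BaseChange

/-! ### Descent along finite jointly faithfully flat families -/

section Descent

variable {R : Type u} [CommRing R] {ι : Type u}

/-- A family of flat `R`-algebras that is jointly faithfully flat. -/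
structure IsFaithfullyFlatFamily (S : ι → Type u) [∀ k, CommRing (S k)]
    [∀ k, Algebra R (S k)] : Prop where
  flat : ∀ k, Module.Flat R (S k)
  eq_zero : ∀ (N : Type u) [AddCommGroup N] [Module R N] (x : N),
    (∀ k, (1 : S k) ⊗ₜ[R] x = 0) → x = 0

variable {S : ι → Type u} [∀ k, CommRing (S k)] [∀ k, Algebra R (S k)]
  {M : Type u} [AddCommGroup M] [Module R M] {κ : Cardinal.{u}}

lemma IsFaithfullyFlatFamily.flat_descends (hS : IsFaithfullyFlatFamily (R := R) S)
    (h : ∀ k, Module.Flat (S k) (S k ⊗[R] M)) : Module.Flat R M := by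
  refine flat_iff_tensorReflects.mpr fun P Q _ _ _ _ f hf x hx => hS.eq_zero _ x fun k => ?_
  have := hS.flat k
  have := h k
  have : Module.Flat R (S k ⊗[R] M) := .trans R (S k) _
  have hinj := Module.Flat.lTensor_preserves_injective_linearMap (M := S k ⊗[R] M) f hf
  have h0 : f.lTensor (S k ⊗[R] M) ((TensorProduct.assoc R _ _ _).symm (1 ⊗ₜ[R] x)) = 0 := by
    rw [LinearMap.lTensor_tensor]
    simp [hx PUnit.unit]
  have := (injective_iff_map_eq_zero _).mp hinj _ h0
  simpa using this

/-- The product of the `Q i` embeds in the product over `k` and `i` of `S k ⊗ Q i`, and flatness of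
`M` preserves the embedding. Finiteness of `ι` lets `M ⊗ -` commute with the product over `k`. For
each `k`, the hypothesis over `S k` handles the product over `i`. -/
lemma IsFaithfullyFlatFamily.isMittagLeffler_descends [Finite ι]
    (hS : IsFaithfullyFlatFamily (R := R) S) [Module.Flat R M]
    (h : ∀ k, IsMittagLeffler (S k) (S k ⊗[R] M)) : IsMittagLeffler R M := by
  classical
  have := Fintype.ofFinite ι
  refine isMittagLeffler_iff_tensorReflects.mpr fun I Q _ _ x hx => ?_
  let j (k : ι) : (∀ i, Q i) →ₗ[R] (∀ i, S k ⊗[R] Q i) :=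
    LinearMap.pi fun i => TensorProduct.mk R (S k) (Q i) 1 ∘ₗ LinearMap.proj i
  have hj : Function.Injective (LinearMap.pi j) := by
    rw [injective_iff_map_eq_zero]
    intro q hq
    ext i
    exact hS.eq_zero _ _ fun k => congrFun (congrFun hq k) i
  refine (injective_iff_map_eq_zero _).mp
    (Module.Flat.lTensor_preserves_injective_linearMap (M := M) _ hj) x ?_
  refine (TensorProduct.piRight R R M fun k => ∀ i, S k ⊗[R] Q i).injective ?_
  rw [map_zero, TensorProduct.piRight_apply]
  ext1 k
  rw [piRightHom_apply, ← LinearMap.lTensor_comp_apply]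
  refine (tensorReflects_baseChange_iff _).mp (isMittagLeffler_iff_tensorReflects.mp (h k) I
    fun i => S k ⊗[R] Q i) _ fun i => ?_
  rw [← LinearMap.lTensor_comp_apply]
  have : LinearMap.restrictScalars R (LinearMap.proj i :
      (∀ i, S k ⊗[R] Q i) →ₗ[S k] S k ⊗[R] Q i) ∘ₗ LinearMap.proj k ∘ₗ LinearMap.pi j =
      TensorProduct.mk R (S k) (Q i) 1 ∘ₗ LinearMap.proj i := rfl
  rw [this, LinearMap.lTensor_comp_apply, hx, map_zero]

lemma IsFaithfullyFlatFamily.isFlatMittagLeffler_descends [Finite ι]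
    (hS : IsFaithfullyFlatFamily (R := R) S)
    (h : ∀ k, IsFlatMittagLeffler (S k) (S k ⊗[R] M)) : IsFlatMittagLeffler R M :=
  have := hS.flat_descends fun k => (h k).1
  ⟨this, hS.isMittagLeffler_descends fun k => (h k).2⟩

lemma IsFaithfullyFlatFamily.le_of_baseChange_le (hS : IsFaithfullyFlatFamily (R := R) S)
    {A C : Submodule R M} (h : ∀ k, A.baseChange (S k) ≤ C.baseChange (S k)) : A ≤ C := by
  intro a ha
  rw [← Submodule.Quotient.mk_eq_zero]
  refine hS.eq_zero _ _ fun k => ?_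
  have h1 := h k (Submodule.tmul_mem_baseChange_of_mem 1 ha)
  rw [← Submodule.ker_mkQ C, ← ker_baseChange _ C.mkQ_surjective, LinearMap.mem_ker] at h1
  simpa using h1

/-- For each `k`, a small `D k ≤ A` already has the full base change to `S k`. The sum of the `D k`
is then all of `A` by joint faithful flatness. -/
lemma IsFaithfullyFlatFamily.isGeneratedLE_descends (hκ : ℵ₀ ≤ κ) [Finite ι]
    (hS : IsFaithfullyFlatFamily (R := R) S)
    {A : Submodule R M} (h : ∀ k, IsGeneratedLE κ (A.baseChange (S k))) : IsGeneratedLE κ A := by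
  choose D hDA hDg hD using fun k =>
    exists_isGeneratedLE_le_baseChange (S k) hκ A _ (h k) le_rfl
  have : A = ⨆ k, D k := le_antisymm (hS.le_of_baseChange_le fun k =>
    (hD k).trans (Submodule.baseChange_mono _ (le_iSup D k))) (iSup_le hDA)
  rw [this]
  exact isGeneratedLE_iSup hκ ((Cardinal.mk_lt_aleph0 ..).le.trans hκ) hDg

lemma IsFaithfullyFlatFamily.isPresentedLE_descends (hκ : ℵ₀ ≤ κ) [Finite ι]
    (hS : IsFaithfullyFlatFamily (R := R) S)
    (h : ∀ k, IsPresentedLE (S k) (S k ⊗[R] M) κ) : IsPresentedLE R M κ := by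
  obtain ⟨s, hs, hst⟩ : IsGeneratedLE κ (⊤ : Submodule R M) :=
    hS.isGeneratedLE_descends hκ fun k => by
      rw [Submodule.baseChange_top]
      exact (h k).isGeneratedLE_top
  have hf : Function.Surjective (Finsupp.linearCombination R ((↑) : s → M)) := by
    rw [← LinearMap.range_eq_top, Finsupp.range_linearCombination, Subtype.range_coe, hst]
  refine isPresentedLE_iff.mpr ⟨s, _, hs, hf, hS.isGeneratedLE_descends hκ fun k => ?_⟩
  rw [← ker_baseChange _ hf]
  refine (h k).isGeneratedLE_ker hκ ?_ _ (LinearMap.lTensor_surjective (S k) hf)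
  rw [← Submodule.baseChange_top]
  exact (isGeneratedLE_top_finsupp hs).baseChange (S k)

/-- The transfinite iteration of a self-map of the lattice of submodules, with suprema taken at
limits. -/
noncomputable def iterateChain (next : Submodule R M → Submodule R M) (α : Ordinal.{u}) :
    Submodule R M :=
  ⨆ β : Set.Iio α, next (iterateChain next β.1)
termination_by α
decreasing_by exact β.2

/-- A module is a transfinite extension of modules from `C` if it has a family of submodules
closed under sums in which each proper submodule has a larger one modulo it in `C`. -/
lemma isTransfiniteExtension_of_step
    {C : ∀ (N : Type u) [AddCommGroup N] [Module R N], Prop} (H : Set (Submodule R M))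
    (hH : ∀ 𝒜 ⊆ H, sSup 𝒜 ∈ H)
    (hstep : ∀ A ∈ H, A ≠ ⊤ → ∃ B ∈ H, A < B ∧ C (B.map A.mkQ)) :
    IsTransfiniteExtension R M C := by
  classical
  choose! B hBH hAB hBC using hstep
  let next : Submodule R M → Submodule R M := fun A => if A ∈ H ∧ A ≠ ⊤ then B A else A
  have hle (A) : A ≤ next A := by
    by_cases h : A ∈ H ∧ A ≠ ⊤
    · simpa [next, h] using (hAB A h.1 h.2).le
    · simp [next, h]
  let F := iterateChain next
  have hF (α) : F α = ⨆ β : Set.Iio α, next (F β) := by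
    simp only [F]
    rw [iterateChain]
  have hmono : Monotone F := by
    intro α β hαβ
    rw [hF, hF]
    exact iSup_le fun γ => le_iSup (fun γ : Set.Iio β => next (F γ)) ⟨γ, γ.2.trans_le hαβ⟩
  have hFH (α) : F α ∈ H := by
    induction α using WellFoundedLT.induction with
    | ind α ih =>
    rw [hF, iSup]
    refine hH _ ?_
    rintro _ ⟨β, rfl⟩
    by_cases h : F β ∈ H ∧ F β ≠ ⊤
    · simpa only [next, if_pos h] using hBH _ h.1 h.2
    · simpa only [next, if_neg h] using ih _ β.2
  have hsucc (α) : F (Order.succ α) = next (F α) := by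
    rw [hF]
    refine le_antisymm (iSup_le fun β => ?_)
      (le_iSup (fun γ : Set.Iio (Order.succ α) => next (F γ)) ⟨α, Order.lt_succ α⟩)
    rcases (Order.lt_succ_iff.mp (Set.mem_Iio.mp β.2)).eq_or_lt with h | h
    · rw [h]
    · refine le_trans ?_ (hle (F α))
      rw [hF α]
      exact le_iSup (fun γ : Set.Iio α => next (F γ)) ⟨β, h⟩
  have hnext (α) (h : F α ≠ ⊤) : F (Order.succ α) = B (F α) := by
    rw [hsucc]
    exact if_pos ⟨hFH α, h⟩
  -- Otherwise `F` would be strictly increasing on all ordinals and embed them in the small set of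
  -- submodules of `M`.
  have hex : ∃ σ, F σ = ⊤ := by
    by_contra! hne
    refine not_injective_of_ordinal F (StrictMono.injective fun α β hαβ => ?_)
    refine lt_of_lt_of_le ?_ (hmono (Order.succ_le_of_lt hαβ))
    rw [hnext α (hne α)]
    exact hAB _ (hFH α) (hne α)
  refine ⟨sInf {σ | F σ = ⊤}, F, fun α β h _ => hmono h, ?_, ?_,
    csInf_mem (s := {σ | F σ = ⊤}) hex, ?_⟩
  · rw [hF]
    simp
  · intro α _ hl
    have : F α = ⨆ β : Set.Iio α, F β := by
      refine le_antisymm ?_ (iSup_le fun β => hmono β.2.le)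
      rw [hF]
      refine iSup_le fun β => ?_
      rw [← hsucc]
      exact le_iSup (fun γ : Set.Iio α => F γ) ⟨_, hl.succ_lt β.2⟩
    rw [this]
    have : Nonempty (Set.Iio α) := ⟨⟨0, by simpa using hl.bot_lt⟩⟩
    exact Submodule.coe_iSup_of_directed _
      (Monotone.directed_le fun β γ hβγ => hmono hβγ)
  · intro α hα
    have hne : F α ≠ ⊤ := fun h => notMem_of_lt_csInf' hα h
    obtain ⟨e⟩ := nonempty_map_mkQ_equiv (A := F α) (B := F (Order.succ α))
    refine ⟨_, inferInstance, inferInstance, ?_, ⟨e⟩⟩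
    rw [hnext α hne]
    exact hBC _ (hFH α) hne

/-- Zigzag: submodules `C n` of `M` and members `D n` of `H₀ k` alternate, the base change of `C n`
lying in `D n` and `D n` in that of `C (n + 1)`, for all `k` at once. In the limit the two unions
agree, and `H₀ k` is closed under countable sums. -/
lemma exists_isGeneratedLE_baseChange_mem (hκ : ℵ₀ ≤ κ) [Finite ι]
    {H H₀ : ∀ k, Set (Submodule (S k) (S k ⊗[R] M))} (hH : ∀ k, IsHillFamily κ (H k) (H₀ k))
    (x : M) : ∃ C : Submodule R M, x ∈ C ∧ ∀ k, C.baseChange (S k) ∈ H₀ k := by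
  have hι : #ι ≤ κ := (Cardinal.mk_lt_aleph0 ..).le.trans hκ
  have step (C : Submodule R M) (hC : IsGeneratedLE κ C) :
      ∃ C' : Submodule R M, IsGeneratedLE κ C' ∧ C ≤ C' ∧
        ∀ k, ∃ D ∈ H₀ k, C.baseChange (S k) ≤ D ∧ D ≤ C'.baseChange (S k) := by
    choose D hD hCD using fun k => (hH k).exists_le _ (hC.baseChange (S k))
    choose E hE hEg hDE using fun k => exists_isGeneratedLE_le_baseChange (S k) hκ (⊤ : Submodule R M)
      (D k) ((hH k).isGeneratedLE _ (hD k)) (by simp)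
    exact ⟨C ⊔ ⨆ k, E k, hC.sup hκ (isGeneratedLE_iSup hκ hι hEg), le_sup_left, fun k =>
      ⟨D k, hD k, hCD k, (hDE k).trans (Submodule.baseChange_mono _
        ((le_iSup E k).trans le_sup_right))⟩⟩
  choose! next hg hle hD using step
  let C : ℕ → Submodule R M := fun n => next^[n] (Submodule.span R {x})
  have hC (n) : C (n + 1) = next (C n) := Function.iterate_succ_apply' _ _ _
  have hCg (n) : IsGeneratedLE κ (C n) := by
    induction n with
    | zero => exact isGeneratedLE_of_finite hκ (Set.finite_singleton x)
    | succ n ih => rw [hC]; exact hg _ ih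
  refine ⟨⨆ n, C n, Submodule.mem_iSup_of_mem 0 (Submodule.mem_span_singleton_self x), fun k => ?_⟩
  choose D hDH hCD hDC using fun n => hD (C n) (hCg n) k
  have : (⨆ n, C n).baseChange (S k) = ⨆ n, D n := by
    rw [baseChange_iSup]
    refine le_antisymm (iSup_mono hCD) (iSup_le fun n => ?_)
    refine (hDC n).trans ?_
    rw [← hC]
    exact le_iSup (fun n => (C n).baseChange (S k)) (n + 1)
  rw [this]
  exact (hH k).iSup_nat_mem D hDH

/-- `κ`-restricted flat Mittag-Leffler modules descend along finite jointly faithfully flat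
families. -/
theorem IsFaithfullyFlatFamily.isRestrictedFlatMittagLeffler_descends (hκ : ℵ₀ ≤ κ) [Finite ι]
    (hS : IsFaithfullyFlatFamily (R := R) S)
    (h : ∀ k, IsRestrictedFlatMittagLeffler (S k) (S k ⊗[R] M) κ) :
    IsRestrictedFlatMittagLeffler R M κ := by
  have := hS.flat
  choose H H₀ hH using fun k => (h k).exists_isHillFamily hκ
  let HM : Set (Submodule R M) := {A | ∀ k, A.baseChange (S k) ∈ H k}
  have hHM : ∀ 𝒜 ⊆ HM, sSup 𝒜 ∈ HM := by
    intro 𝒜 h𝒜 k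
    rw [sSup_eq_iSup', baseChange_iSup, iSup]
    refine (hH k).sSup_mem _ ?_
    rintro _ ⟨A, rfl⟩
    exact h𝒜 A.2 k
  have hquot (A) (hA : A ∈ HM) : IsFlatMittagLeffler R (M ⧸ A) :=
    hS.isFlatMittagLeffler_descends fun k => by
      obtain ⟨e, -⟩ := exists_quotient_baseChange_equiv (S k) A
      exact ((hH k).quotient _ (hA k)).congr e.symm
  refine isTransfiniteExtension_of_step HM hHM fun A hA hne => ?_
  obtain ⟨x, hx⟩ := not_forall.mp fun h => hne (Submodule.eq_top_iff'.mpr h)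
  obtain ⟨C, hxC, hC⟩ := exists_isGeneratedLE_baseChange_mem hκ hH x
  have hCM : C ∈ HM := fun k => (hH k).subset (hC k)
  have hB : A ⊔ C ∈ HM := by
    rw [← sSup_pair]
    refine hHM _ ?_
    rintro _ (rfl | rfl) <;> assumption
  refine ⟨A ⊔ C, hB, left_lt_sup.mpr fun h => hx (h hxC), ?_, ?_⟩
  · have : (A ⊔ C).map A.mkQ = C.map A.mkQ := by
      rw [Submodule.map_sup, Submodule.mkQ_map_self, bot_sup_eq]
    rw [this]
    refine hS.isPresentedLE_descends hκ fun k => ?_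
    obtain ⟨e⟩ := nonempty_tensor_map_mkQ_equiv (S k) A C
    exact ((hH k).isPresentedLE _ (hA k) _ (hC k)).congr e.symm
  -- This quotient is `M ⧸ (A ⊔ C)`, flat because `A ⊔ C ∈ HM`. So the new factor is pure in the
  -- flat Mittag-Leffler module `M ⧸ A`.
  · have : Module.Flat R ((M ⧸ A) ⧸ (A ⊔ C).map A.mkQ) :=
      have := (hquot _ hB).1
      .of_linearEquiv (Submodule.quotientQuotientEquivQuotient A (A ⊔ C) le_sup_left)
    exact (hquot A hA).submodule _

lemma isFaithfullyFlatFamily_of_faithfullyFlat (T : Type u) [CommRing T] [Algebra R T]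
    [Module.FaithfullyFlat R T] :
    IsFaithfullyFlatFamily (R := R) (fun _ : PUnit.{u + 1} => T) where
  flat _ := inferInstance
  eq_zero N _ _ _ hx := Module.FaithfullyFlat.tensorProduct_mk_injective (A := R) (B := T) N
    ((hx PUnit.unit).trans (TensorProduct.tmul_zero N (1 : T)).symm)

/-- Being a `κ`-restricted flat Mittag-Leffler module is an ad-property. -/
theorem isADProperty_restrictedFlatMittagLeffler (hκ : ℵ₀ ≤ κ) :
    IsADProperty (restrictedFlatMittagLeffler κ) :=
  ⟨fun _ _ _ _ _ _ _ _ _ h => IsRestrictedFlatMittagLeffler.baseChange h,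
    fun _ S _ _ _ _ _ _ _ h => (isFaithfullyFlatFamily_of_faithfullyFlat S
      ).isRestrictedFlatMittagLeffler_descends hκ fun _ => h⟩

end Descent

/-! ### Isomorphism invariance and localization covers -/

section

variable {R : Type u} [CommRing R] {M N : Type u} [AddCommGroup M] [Module R M]
  [AddCommGroup N] [Module R N]

lemma IsRestrictedFlatMittagLeffler.congr {κ : Cardinal.{u}}
    (h : IsRestrictedFlatMittagLeffler R M κ) (e : M ≃ₗ[R] N) :
    IsRestrictedFlatMittagLeffler R N κ := by
  obtain ⟨σ, F, hmono, hzero, hlim, htop, hfac⟩ := h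
  refine ⟨σ, fun α => (F α).map e.toLinearMap,
    fun α β hαβ hβ => Submodule.map_mono (hmono α β hαβ hβ), by simp [hzero], ?_,
    by simp [htop], ?_⟩
  · intro α hα hl
    rw [Submodule.map_coe, hlim α hα hl, Set.image_iUnion]
    rfl
  · intro α hα
    obtain ⟨K, _, _, hK, ⟨e₁⟩⟩ := hfac α hα
    obtain ⟨e₂⟩ := nonempty_quotient_submoduleOf_equiv e.toLinearMap (F (Order.succ α)) (F α)
      ((F (Order.succ α)).map e.toLinearMap) ((F α).map e.toLinearMap) le_rfl le_sup_left
      fun a _ => e.injective.mem_set_image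
    exact ⟨K, inferInstance, inferInstance, hK, ⟨e₂.symm.trans e₁⟩⟩

lemma isFaithfullyFlatFamily_of_away (s : Finset R) (hs : Ideal.span (s : Set R) = ⊤)
    (S : s → Type u) [∀ k, CommRing (S k)] [∀ k, Algebra R (S k)]
    [∀ k : s, IsLocalization.Away (k : R) (S k)] : IsFaithfullyFlatFamily (R := R) S where
  flat k := IsLocalization.flat (S k) (Submonoid.powers (k : R))
  eq_zero N _ _ x hx := by
    have (k : (s : Set R)) : IsLocalizedModule.Away (k : R) (TensorProduct.mk R (S k) N 1) :=
      (isLocalizedModule_iff_isBaseChange (Submonoid.powers (k : R)) (S k) _).mpr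
        (TensorProduct.isBaseChange R N (S k))
    exact Module.eq_zero_of_isLocalized_span (s : Set R) hs (fun k => S k ⊗[R] N)
      (fun k => TensorProduct.mk R (S k) N 1) x hx

end

/-! ### Quasi-coherent sheaves on basic opens -/

section Schemes

open AlgebraicGeometry CategoryTheory Opposite TopologicalSpace

/-- The sections over `V` of the restriction of `M` to the spectrum of the sections over `U`. -/
noncomputable def _root_.AlgebraicGeometry.IsAffineOpen.restrictFromSpecIso {X : Scheme.{u}}
    {U : X.Opens} (hU : IsAffineOpen U) (M : X.Modules) {V : (Spec Γ(X, U)).Opens} {W : X.Opens}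
    (h : hU.fromSpec ''ᵁ V = W) : Γ(M.restrict hU.fromSpec, V) ≅ Γ(M, W) :=
  M.restrictAppIso hU.fromSpec V ≪≫ M.presheaf.mapIso (eqToIso h.symm).op

lemma _root_.AlgebraicGeometry.IsAffineOpen.restrictFromSpecIso_hom_smul {X : Scheme.{u}}
    {U : X.Opens} (hU : IsAffineOpen U) (M : X.Modules) {V : (Spec Γ(X, U)).Opens} {W : X.Opens}
    (h : hU.fromSpec ''ᵁ V = W) (hW : W ≤ U) (r : Γ(X, U)) (x : Γ(M.restrict hU.fromSpec, V)) :
    (hU.restrictFromSpecIso M h).hom (r • x) =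
      X.presheaf.map (homOfLE hW).op r • (hU.restrictFromSpecIso M h).hom x := by
  subst h
  have key : (Scheme.ΓSpecIso Γ(X, U)).inv ≫ (Spec Γ(X, U)).presheaf.map V.leTop.op ≫
      (hU.fromSpec.appIso V).inv = X.presheaf.map (homOfLE hW).op := by
    rw [← Category.assoc, Iso.comp_inv_eq, Scheme.Hom.appIso_hom', Scheme.Hom.map_appLE,
      Scheme.Hom.appLE, hU.fromSpec_app_self, Category.assoc, ← Functor.map_comp]
    rfl
  rw [Scheme.Modules.smul_Spec_def, ← key]
  change (_ ≫ M.presheaf.map (𝟙 _)) _ = _ • (_ ≫ M.presheaf.map (𝟙 _)) _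
  rw [CategoryTheory.Functor.map_id, Category.comp_id]
  exact Scheme.Modules.smul_restrictAppIso_hom_apply _ _ _ _ _

lemma _root_.AlgebraicGeometry.IsAffineOpen.restrictFromSpecIso_hom_map {X : Scheme.{u}}
    {U : X.Opens} (hU : IsAffineOpen U) (M : X.Modules) {V V' : (Spec Γ(X, U)).Opens}
    {W W' : X.Opens} (h : hU.fromSpec ''ᵁ V = W) (h' : hU.fromSpec ''ᵁ V' = W') (i : V ⟶ V')
    (j : W ⟶ W') (x : Γ(M.restrict hU.fromSpec, V')) :
    (hU.restrictFromSpecIso M h).hom ((M.restrict hU.fromSpec).presheaf.map i.op x) =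
      M.presheaf.map j.op ((hU.restrictFromSpecIso M h').hom x) := by
  subst h h'
  simp [IsAffineOpen.restrictFromSpecIso]
  rfl

/-- On the spectrum of `Γ(X, U)`, quasi-coherence says that restriction to a basic open is
localization at `f`. This is carried back to `X` along `hU.fromSpec`, and a localization is a base
change. -/
lemma _root_.AlgebraicGeometry.IsAffineOpen.nonempty_tensor_basicOpen_equiv {X : Scheme.{u}}
    {U : X.Opens} (hU : IsAffineOpen U) (M : X.Modules) [M.IsQuasicoherent] (f : Γ(X, U)) :
    Nonempty (Γ(X, X.basicOpen f) ⊗[Γ(X, U)] Γ(M, U) ≃ₗ[Γ(X, X.basicOpen f)]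
      Γ(M, X.basicOpen f)) := by
  -- Only two facts about the localization are kept: surjectivity up to powers of `f`, and `f`-power
  -- torsion of the kernel. Both transfer along the isomorphisms `eT` and `eD`, which respect the
  -- action of `Γ(X, U)`.
  obtain ⟨D, hD, hsurj, hker⟩ : ∃ D : (Spec Γ(X, U)).Opens,
      hU.fromSpec ''ᵁ D = X.basicOpen f ∧
      (∀ x : Γ(M.restrict hU.fromSpec, D), ∃ (n : ℕ) (y : Γ(M.restrict hU.fromSpec, ⊤)),
        f ^ n • x = (M.restrict hU.fromSpec).presheaf.map D.leTop.op y) ∧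
      ∀ y : Γ(M.restrict hU.fromSpec, ⊤),
        (M.restrict hU.fromSpec).presheaf.map D.leTop.op y = 0 → ∃ n : ℕ, f ^ n • y = 0 := by
    have hN := (isIso_fromTildeΓ_iff_isLocalizing (M.restrict hU.fromSpec)).mp inferInstance f
    refine ⟨PrimeSpectrum.basicOpen f, hU.fromSpec_image_basicOpen f, fun x => ?_, fun y hy => ?_⟩
    · obtain ⟨⟨y, ⟨_, n, rfl⟩⟩, hy⟩ := hN.surj x
      exact ⟨n, y, hy⟩
    · obtain ⟨⟨_, n, rfl⟩, hn⟩ := (@IsLocalizedModule.eq_zero_iff _ _ _ _ _ _ _ _ _ _ hN y).mp hy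
      exact ⟨n, hn⟩
  have hle : X.basicOpen f ≤ U := X.basicOpen_le f
  have hT : hU.fromSpec ''ᵁ ⊤ = U := by
    rw [Scheme.Hom.image_top_eq_opensRange, hU.opensRange_fromSpec]
  let eT := hU.restrictFromSpecIso M hT
  let eD := hU.restrictFromSpecIso M hD
  have := hU.isLocalization_basicOpen f
  let := Module.compHom Γ(M, X.basicOpen f) (algebraMap Γ(X, U) Γ(X, X.basicOpen f))
  have : IsScalarTower Γ(X, U) Γ(X, X.basicOpen f) Γ(M, X.basicOpen f) :=
    .of_algebraMap_smul fun _ _ => rfl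
  have hsmul (r : Γ(X, U)) (x) : eD.hom (r • x) = r • eD.hom x :=
    hU.restrictFromSpecIso_hom_smul M hD hle r x
  have hsmul' (r : Γ(X, U)) (x) : eT.hom (r • x) = r • eT.hom x := by
    refine (hU.restrictFromSpecIso_hom_smul M hT le_rfl r x).trans ?_
    rw [show (homOfLE le_rfl : U ⟶ U) = 𝟙 U from rfl]
    simp [eT]
  let ρ : Γ(M, U) →ₗ[Γ(X, U)] Γ(M, X.basicOpen f) :=
    { toFun := M.presheaf.map (homOfLE hle).op
      map_add' := map_add _
      map_smul' := fun r x => M.map_smul (homOfLE hle) r x }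
  have hρ (x) : eD.hom ((M.restrict hU.fromSpec).presheaf.map
      D.leTop.op x) = ρ (eT.hom x) :=
    hU.restrictFromSpecIso_hom_map M hD hT _ _ x
  have hloc : IsLocalizedModule.Away f ρ := by
    refine .mk_of_addCommGroup ?_ (fun x => ?_) fun x hx => ?_
    · rw [← (Algebra.lsmul Γ(X, U) (A := Γ(X, X.basicOpen f)) Γ(X, U)
        Γ(M, X.basicOpen f)).commutes]
      exact (IsLocalization.Away.algebraMap_isUnit f).map _
    · obtain ⟨n, y, hy⟩ := hsurj (eD.inv x)
      refine ⟨n, eT.hom y, ?_⟩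
      rw [← hρ, ← hy, hsmul, Iso.inv_hom_id_apply]
    · obtain ⟨n, hn⟩ := hker (eT.inv x) (by
        apply (ConcreteCategory.bijective_of_isIso eD.hom).1
        rw [hρ, Iso.inv_hom_id_apply, hx, map_zero])
      refine ⟨n, ?_⟩
      have := hsmul' (f ^ n) (eT.inv x)
      rwa [hn, Iso.inv_hom_id_apply, map_zero, eq_comm] at this
  exact ⟨(IsLocalizedModule.isBaseChange (.powers f) Γ(X, X.basicOpen f) ρ).equiv⟩

end Schemes

end RestrictedML

/-- Being a `κ`-restricted flat Mittag-Leffler module is an ad-property, and the notion of a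
`κ`-restricted Drinfeld vector bundle is Zariski local on every scheme: it can be checked on any
family of affine opens covering the scheme. -/
theorem theorem4p6 (κ : Cardinal.{u}) (hκ : ℵ₀ ≤ κ) :
    RestrictedML.IsADProperty (RestrictedML.restrictedFlatMittagLeffler κ) ∧
    ∀ (X : AlgebraicGeometry.Scheme.{u}) (M : X.Modules), M.IsQuasicoherent →
      ∀ 𝒰 : Set X.affineOpens, (⋃ U ∈ 𝒰, ((U : X.Opens) : Set X)) = Set.univ →
        (RestrictedML.IsRestrictedDrinfeldVectorBundle κ M ↔
          ∀ U ∈ 𝒰, RestrictedML.IsRestrictedFlatMittagLeffler Γ(X, U) Γ(M, U) κ) := by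
  refine ⟨RestrictedML.isADProperty_restrictedFlatMittagLeffler hκ, fun X M hM 𝒰 h𝒰 =>
    ⟨fun h U _ => h.2 U, fun h => ⟨hM, fun V => ?_⟩⟩⟩
  have hsup : ⨆ U : 𝒰, (U.1 : X.Opens) = ⊤ := by
    refine TopologicalSpace.Opens.ext ?_
    rw [TopologicalSpace.Opens.coe_iSup, TopologicalSpace.Opens.coe_top, ← h𝒰,
      Set.biUnion_eq_iUnion]
  -- Affine communication: ascent gives passage to a basic open, and descent along the finite family
  -- of localizations gives passage back from basic opens whose functions span the unit ideal.
  refine AlgebraicGeometry.of_affine_open_cover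
    (P := fun U : X.affineOpens => RestrictedML.IsRestrictedFlatMittagLeffler Γ(X, U) Γ(M, U) κ)
    (fun U : 𝒰 => U.1) hsup V (fun U f hU => ?_) (fun U s hs hU => ?_) fun U => h U.1 U.2
  · obtain ⟨e⟩ := U.2.nonempty_tensor_basicOpen_equiv M f
    have := U.2.isLocalization_basicOpen f
    have : Module.Flat Γ(X, U) Γ(X, X.basicOpen f) :=
      IsLocalization.flat _ (Submonoid.powers f)
    exact (show RestrictedML.IsRestrictedFlatMittagLeffler Γ(X, X.basicOpen f)
      Γ(M, X.basicOpen f) κ from hU.baseChange.congr e)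
  · have (k : s) : IsLocalization.Away k.1 Γ(X, X.basicOpen k.1) :=
      U.2.isLocalization_basicOpen k.1
    refine (RestrictedML.isFaithfullyFlatFamily_of_away s hs
      fun k => Γ(X, X.basicOpen k.1)).isRestrictedFlatMittagLeffler_descends hκ fun k => ?_
    obtain ⟨e⟩ := U.2.nonempty_tensor_basicOpen_equiv M k.1
    exact (show RestrictedML.IsRestrictedFlatMittagLeffler Γ(X, X.basicOpen k.1)
      Γ(M, X.basicOpen k.1) κ from hU k).congr e.symm
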